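/- All graphs are finite and simple. A total $2$-weighting of a graph $G$ is a map $w\colon V(G)\cup E(G)\to\{1,2\}$; it is proper if $\phi_w(x)\neq\phi_w(y)$ for every edge $xy$ of $G$, where $\phi_w(v)=w(v)+\sum_{e\ni v}w(e)$, the sum being over the edges of $G$ incident to $v$. A graph is $2$-bad if it has no proper total $2$-weighting, and minimal $2$-bad if it is $2$-bad but none of its proper subgraphs is $2$-bad. A configuration is $2$-reducible if no minimal $2$-bad graph contains it. A $k$-vertex, $k^-$-vertex or $k^+$-vertex is a vertex whose degree in $G$ is equal to $k$, at most $k$ or at least $k$, respectively; a $k$-neighbor or $k^-$-neighbor of $v$ is a neighbor of $v$ that is a $k$-vertex or $k^-$-vertex. A $\beta$-vertex is a $3$-vertex having exactly one $2$-neighbor and no $1$-neighbor. A $\beta'$-vertex is a $2k$-vertex, where $k\ge 2$, having exactly $k-1$ neighbors of degree $1$ and no $2$-neighbor. A $\beta'$-neighbor of $v$ is a neighbor of $v$ that is a $\beta'$-vertex. **Lemma 3.4.** Each of the following configurations is $2$-reducible. A. A $3^-$-vertex having a $1$-neighbor. B. A $4^-$-vertex having two $2^-$-neighbors. C. A $5^+$-vertex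 $v$ whose number of $2^-$-neighbors is at least $(d_G(v)-1)/2$, where $d_G(v)$ is the degree of $v$. D. Two adjacent $\beta$-vertices. E. A $\beta$-vertex with a $\beta'$-neighbor. F. A $\beta'$-vertex of degree $4$ having two $\beta'$-neighbors of degree $4$. G. A $3$-vertex such that each neighbor is a $\beta$-vertex or is a $\beta'$-vertex of degree $4$. -/

import Mathlib

universe u

namespace TotalWeighting

/-- A weight on every vertex and every edge of a graph on the vertex set `V`.  The edge part is a
function on all unordered pairs; only its values on the edges of the graph are ever used. -/
structure Weighting (V : Type u) where
  vertex : V → ℕ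
  edge : Sym2 V → ℕ

section Basic

variable {V : Type u} [Fintype V] (G : SimpleGraph V)

open Classical in
/-- The total `φ_w(v)` that the vertex `v` sees: its own weight plus the weights of all edges of
`G` incident to `v` (listed through the neighbours of `v`). -/
noncomputable def color (w : Weighting V) (v : V) : ℕ :=
  w.vertex v + ∑ u ∈ G.neighborFinset v, w.edge s(v, u)

/-- `w` is a total `k`-weighting of `G`: all weights on vertices and edges lie in `{1, …, k}`. -/
def IsTotalWeighting (k : ℕ) (w : Weighting V) : Prop :=
  (∀ v, w.vertex v ∈ Finset.Icc 1 k) ∧ ∀ e ∈ G.edgeSet, w.edge e ∈ Finset.Icc 1 k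

/-- `w` is proper on `G`: adjacent vertices see different totals. -/
def IsProper (w : Weighting V) : Prop :=
  ∀ x y, G.Adj x y → color G w x ≠ color G w y

/-- `G` is 2-bad: it has no proper total 2-weighting. -/
def IsTwoBad : Prop :=
  ¬ ∃ w : Weighting V, IsTotalWeighting G 2 w ∧ IsProper G w

open Classical in
/-- `G` is a minimal 2-bad graph: it is 2-bad and no proper subgraph of it (edges and vertices may
be deleted) is 2-bad. -/
def IsMinimalTwoBad : Prop :=
  IsTwoBad G ∧ ∀ H : G.Subgraph, H ≠ ⊤ → ¬ IsTwoBad H.coe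

open Classical in
/-- The degree of `v` in `G`. -/
noncomputable def deg (v : V) : ℕ := G.degree v

open Classical in
/-- The number of neighbours of `v` of degree exactly `j`. -/
noncomputable def numNeighbors (j : ℕ) (v : V) : ℕ :=
  ((G.neighborFinset v).filter fun u => deg G u = j).card

open Classical in
/-- The number of neighbours of `v` of degree at most `j`. -/
noncomputable def numNeighborsLE (j : ℕ) (v : V) : ℕ :=
  ((G.neighborFinset v).filter fun u => deg G u ≤ j).card

/-- A `β`-vertex: a 3-vertex having exactly one 2-neighbour and no 1-neighbour. -/
def IsBeta (v : V) : Prop :=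
  deg G v = 3 ∧ numNeighbors G 2 v = 1 ∧ numNeighbors G 1 v = 0

/-- A `β'`-vertex: a vertex of degree `2k` with `k ≥ 2`, having exactly `k - 1` neighbours of
degree 1 and no 2-neighbour. -/
def IsBeta' (v : V) : Prop :=
  ∃ k : ℕ, 2 ≤ k ∧ deg G v = 2 * k ∧ numNeighbors G 1 v = k - 1 ∧ numNeighbors G 2 v = 0

end Basic

/-- A configuration, identified with the property "the finite simple graph `G` contains it". -/
abbrev Configuration : Type (u + 1) :=
  ∀ (V : Type u) [Fintype V], SimpleGraph V → Prop

/-- A configuration is 2-reducible if no minimal 2-bad (finite simple) graph contains it. -/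
def IsTwoReducible (C : Configuration.{u}) : Prop :=
  ∀ (V : Type u) [Fintype V] (G : SimpleGraph V), IsMinimalTwoBad G → ¬ C V G

/-- A vertex of degree at most 3 having a neighbour of degree 1. -/
def configA : Configuration.{u} := fun _ _ G =>
  ∃ v u, deg G v ≤ 3 ∧ G.Adj v u ∧ deg G u = 1

/-- A vertex of degree at most 4 having two neighbours of degree at most 2. -/
def configB : Configuration.{u} := fun _ _ G =>
  ∃ v u u', deg G v ≤ 4 ∧ u ≠ u' ∧ G.Adj v u ∧ G.Adj v u' ∧ deg G u ≤ 2 ∧ deg G u' ≤ 2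

/-- A vertex `v` of degree `d ≥ 5` having at least `(d - 1) / 2` neighbours of degree at most 2. -/
def configC : Configuration.{u} := fun _ _ G =>
  ∃ v, 5 ≤ deg G v ∧ ((deg G v : ℚ) - 1) / 2 ≤ (numNeighborsLE G 2 v : ℚ)

/-- Two adjacent `β`-vertices. -/
def configD : Configuration.{u} := fun _ _ G =>
  ∃ v v', G.Adj v v' ∧ IsBeta G v ∧ IsBeta G v'

/-- A `β`-vertex with a `β'`-neighbour. -/
def configE : Configuration.{u} := fun _ _ G =>
  ∃ v v', G.Adj v v' ∧ IsBeta G v ∧ IsBeta' G v'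

/-- A `β'`-vertex of degree 4 having two `β'`-neighbours of degree 4. -/
def configF : Configuration.{u} := fun _ _ G =>
  ∃ v z z', IsBeta' G v ∧ deg G v = 4 ∧ z ≠ z' ∧
    (G.Adj v z ∧ IsBeta' G z ∧ deg G z = 4) ∧ (G.Adj v z' ∧ IsBeta' G z' ∧ deg G z' = 4)

/-- A 3-vertex such that each neighbour is a `β`-vertex or a `β'`-vertex of degree 4. -/
def configG : Configuration.{u} := fun _ _ G =>
  ∃ v, deg G v = 3 ∧ ∀ z, G.Adj v z → IsBeta G z ∨ (IsBeta' G z ∧ deg G z = 4)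

end TotalWeighting

/-!
Let `G` be minimal 2-bad and let `T` be a set of vertices with an edge inside. Deleting the edges
inside `T` gives a properly weighted graph. Put all weights of vertices in `T` and of edges inside
`T` to `1`; then no raise of these weights by `0` or `1` makes the weighting proper
(`exists_base_weighting`). The colours of the vertices outside `T` do not depend on the raise. So a
configuration is reducible once such a raise is found.

Here `T` consists of a core `M` and of pendants of degree one or two, each attached to one core
vertex, whose own weights are chosen last: a leaf can always avoid its neighbour's colour, and a
`2`-vertex fails only if its two neighbours show precisely the two colours it can get.
`exists_base_core` reduces the problem to the colours available to the core vertices (`Avail`). A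
core vertex with `k` pendants gets `k + 2` consecutive values, from which the colours of its outer
neighbours are excluded.

For a core of one vertex this settles the configurations A, B and C; here large colours are
harmless, since a `2`-vertex has small colours (`Avail.of_large`). A `β`-vertex as an end of a core
edge has an available colour if the edge has weight `2`, and two available colours for one of the
two weights
(`exists_avail_of_beta`); a `β'`-vertex has an available colour for both weights
(`exists_avail_of_leaves`). Comparing colours along the core edges gives D and E (core of two
vertices), F (core of three) and G (a core star), where the arithmetic is in `exists_raise_star`,
`exists_raise_pair` and `exists_raise_three`. The pendants may fail to be independent only if
`2`-neighbours coincide or are adjacent. These cases are excluded beforehand by taking the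
`2`-vertices into the core (`not_adj_of_deg_le_two`, `false_of_adj_of_common_two`,
`false_of_adj_of_adj_two`, `false_of_common_neighbor_of_common_two`,
`false_of_common_neighbor_of_adj_two`).
-/

namespace TotalWeighting

open Finset
open scoped Classical

/-! ### Avoiding values by small shifts -/

theorem exists_color_of_card_le_one {W : Type*} {s : Finset W} (hs : s.card ≤ 1) (β : W → ℕ) :
    ∃ q, ∀ y ∈ s, β y = q := by
  rcases s.eq_empty_or_nonempty with rfl | ⟨y, hy⟩
  · exact ⟨0, by simp⟩
  · exact ⟨β y, fun z hz => by rw [Finset.card_le_one.1 hs z hz y hy]⟩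

/-- A vertex of current colour `B + b` whose own weight may still be raised by `0` or `1` can dodge
two prescribed colours `p` and `q`, unless these are exactly the two colours it can get. -/
theorem exists_raise_ne {B b p q : ℕ} (h1 : ¬ (p = B + b ∧ q = B + b + 1))
    (h2 : ¬ (p = B + b + 1 ∧ q = B + b)) : ∃ e ≤ 1, B + b + e ≠ p ∧ B + b + e ≠ q := by
  by_cases h : B + b ≠ p ∧ B + b ≠ q
  · exact ⟨0, by omega, by omega, by omega⟩
  · exact ⟨1, by omega, by omega, by omega⟩

/-- Every `n ≤ |s|` is the total of raises by `0` or `1` on the elements of `s`. -/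
theorem exists_sum_eq {W : Type*} (s : Finset W) {n : ℕ} (hn : n ≤ s.card) :
    ∃ b : W → ℕ, (∀ l, b l ≤ 1) ∧ ∑ l ∈ s, b l = n ∧ (n = 0 → b = 0) := by
  obtain ⟨t, ht, rfl⟩ := Finset.exists_subset_card_eq hn
  refine ⟨fun l => if l ∈ t then 1 else 0, fun l => by dsimp only; split_ifs <;> simp, ?_, ?_⟩
  · rw [← Finset.card_filter]
    congr 1
    ext l
    simpa using fun h => ht h
  · intro h
    rw [Finset.card_eq_zero] at h
    subst h
    ext; simp

/-- Among the `k + 1` numbers `B, …, B + k` one is not a colour of the set `s`, if `|s| ≤ k`. -/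
theorem exists_shift_ne {W : Type*} (s : Finset W) (β : W → ℕ) (B k : ℕ) (hs : s.card ≤ k) :
    ∃ n ≤ k, ∀ y ∈ s, B + n ≠ β y := by
  have h1 : (s.image β).card < ((Finset.range (k + 1)).image (B + ·)).card := by
    rw [Finset.card_image_of_injective _ (add_right_injective B), Finset.card_range]
    have := Finset.card_image_le (s := s) (f := β)
    omega
  obtain ⟨p, hp, hp'⟩ := Finset.exists_mem_notMem_of_card_lt_card h1
  obtain ⟨n, hn, rfl⟩ := Finset.mem_image.1 hp
  refine ⟨n, by simpa [Nat.lt_succ_iff] using hn, fun y hy h => hp' ?_⟩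
  exact Finset.mem_image.2 ⟨y, hy, h.symm⟩

theorem exists_shift_ne_two (B Y f : ℕ) : ∃ b ≤ 1, ∃ h ≤ 1, B + b + h ≠ Y ∧ B + b + h ≠ f := by
  by_contra hcon
  push Not at hcon
  have h0 := hcon 0 (by omega) 0 (by omega)
  have h1 := hcon 1 (by omega) 0 (by omega)
  have h2 := hcon 1 (by omega) 1 (by omega)
  omega

/-- Two intervals of three consecutive values, each with one forbidden value. If the first interval
can be shifted by `c ∈ {0, 1}`, one of the two shifts makes the two lists of admissible values
different, and two different lists of at least two values each leave distinct choices even after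
deleting a common value `f`. -/
theorem exists_raise_pair (B₁ Y₁ B₂ Y₂ : ℕ) : ∃ c ≤ 1, ∀ f, ∃ t₁ ≤ 2, ∃ t₂ ≤ 2,
    B₁ + c + t₁ ≠ Y₁ ∧ B₂ + t₂ ≠ Y₂ ∧ B₁ + c + t₁ ≠ f ∧ B₂ + t₂ ≠ f ∧
      B₁ + c + t₁ ≠ B₂ + t₂ := by
  let S : ℕ → ℕ → ℕ → Prop := fun B Y x => B ≤ x ∧ x ≤ B + 2 ∧ x ≠ Y
  have htwo : ∀ B Y f, ∃ x, S B Y x ∧ x ≠ f := by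
    intro B Y f
    by_contra hcon
    push Not at hcon
    have h0 := hcon B
    have h1 := hcon (B + 1)
    have h2 := hcon (B + 2)
    simp only [S] at h0 h1 h2
    omega
  have hdiff : ∃ c ≤ 1, ∃ x, ¬ (S (B₁ + c) Y₁ x ↔ S B₂ Y₂ x) := by
    by_contra hcon
    push Not at hcon
    have h0 := fun x => (hcon 0 (by omega) x).trans (hcon 1 le_rfl x).symm
    have a0 := h0 B₁
    have a1 := h0 (B₁ + 3)
    simp only [S] at a0 a1
    omega
  suffices h : ∃ c ≤ 1, ∀ f, ∃ x y, S (B₁ + c) Y₁ x ∧ S B₂ Y₂ y ∧ x ≠ f ∧ y ≠ f ∧ x ≠ y by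
    obtain ⟨c, hc, h⟩ := h
    refine ⟨c, hc, fun f => ?_⟩
    obtain ⟨x, y, h1, h2, h3, h4, h5⟩ := h f
    simp only [S] at h1 h2
    exact ⟨x - (B₁ + c), by omega, y - B₂, by omega, by omega⟩
  obtain ⟨c, hc, z, hz⟩ := hdiff
  refine ⟨c, hc, fun f => ?_⟩
  by_cases h1 : S (B₁ + c) Y₁ z
  · have h2 : ¬ S B₂ Y₂ z := fun h2 => hz ⟨fun _ => h2, fun _ => h1⟩
    by_cases hzf : z = f
    · subst hzf
      obtain ⟨x, hx, hxf⟩ := htwo (B₁ + c) Y₁ z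
      obtain ⟨y, hy, hyx⟩ := htwo B₂ Y₂ x
      exact ⟨x, y, hx, hy, hxf, fun h => h2 (h ▸ hy), hyx.symm⟩
    · obtain ⟨y, hy, hyf⟩ := htwo B₂ Y₂ f
      exact ⟨z, y, h1, hy, hzf, hyf, fun h => h2 (h ▸ hy)⟩
  · have h2 : S B₂ Y₂ z := by tauto
    by_cases hzf : z = f
    · subst hzf
      obtain ⟨y, hy, hyf⟩ := htwo B₂ Y₂ z
      obtain ⟨x, hx, hxy⟩ := htwo (B₁ + c) Y₁ y
      exact ⟨x, y, hx, hy, fun h => h1 (h ▸ hx), hyf, hxy⟩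
    · obtain ⟨x, hx, hxf⟩ := htwo (B₁ + c) Y₁ f
      exact ⟨x, z, hx, h2, hxf, hzf, fun h => h1 (h ▸ hx)⟩

/-- The centre of a star with two rays. Raising the ray weights by `c` and `c'` moves the three
values of the centre, while the end vertices show the colours `α c` and `α' c'`. For one of the four
choices the centre avoids both of them and the forbidden value `Y`. -/
theorem exists_raise_star (B Y : ℕ) (α α' : ℕ → ℕ) : ∃ c ≤ 1, ∃ c' ≤ 1, ∃ t ≤ 2,
    B + (c + c') + t ≠ Y ∧ B + (c + c') + t ≠ α c ∧ B + (c + c') + t ≠ α' c' := by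
  by_contra hcon
  push Not at hcon
  have H : ∀ c ≤ 1, ∀ c' ≤ 1, ∀ t ≤ 2, B + (c + c') + t = Y ∨ B + (c + c') + t = α c ∨
      B + (c + c') + t = α' c' := by
    intro c hc c' hc' t ht
    have := hcon c hc c' hc' t ht
    tauto
  have h00 := H 0 (by omega) 0 (by omega) 0 (by omega)
  have h01 := H 0 (by omega) 0 (by omega) 1 (by omega)
  have h02 := H 0 (by omega) 0 (by omega) 2 (by omega)
  have h10 := H 0 (by omega) 1 (by omega) 0 (by omega)
  have h11 := H 0 (by omega) 1 (by omega) 1 (by omega)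
  have h12 := H 0 (by omega) 1 (by omega) 2 (by omega)
  have h20 := H 1 (by omega) 0 (by omega) 0 (by omega)
  have h21 := H 1 (by omega) 0 (by omega) 1 (by omega)
  have h22 := H 1 (by omega) 0 (by omega) 2 (by omega)
  have h30 := H 1 (by omega) 1 (by omega) 0 (by omega)
  have h31 := H 1 (by omega) 1 (by omega) 1 (by omega)
  have h32 := H 1 (by omega) 1 (by omega) 2 (by omega)
  clear hcon H
  have hY : Y = B + 2 := by omega
  omega

/-- A centre with two rays, which can choose between two consecutive values `g + c + c'` and
`g + c + c' + 1`. Each end vertex either has two admissible colours for some raise of its ray, or at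
least one admissible colour for every raise. -/
theorem exists_raise_two (g : ℕ) (A A' : ℕ → ℕ → Prop)
    (hA : (∃ c ≤ 1, ∀ f, ∃ p, p ≠ f ∧ A c p) ∨ ∀ c, ∃ p, A c p)
    (hA' : (∃ c ≤ 1, ∀ f, ∃ p, p ≠ f ∧ A' c p) ∨ ∀ c, ∃ p, A' c p) :
    ∃ c ≤ 1, ∃ c' ≤ 1, ∃ h ≤ 1, ∃ p p', p ≠ g + c + c' + h ∧ p' ≠ g + c + c' + h ∧
      A c p ∧ A' c' p' := by
  have havoid : ∀ a b : ℕ, ∃ h ≤ 1, b ≠ a + h := fun a b => by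
    by_cases h : b = a
    · exact ⟨1, by omega, by omega⟩
    · exact ⟨0, by omega, by omega⟩
  rcases hA with ⟨c, hc, hA⟩ | hA <;> rcases hA' with ⟨c', hc', hA'⟩ | hA'
  · obtain ⟨p, hp, hAp⟩ := hA (g + c + c' + 0)
    obtain ⟨p', hp', hAp'⟩ := hA' (g + c + c' + 0)
    exact ⟨c, hc, c', hc', 0, by omega, p, p', hp, hp', hAp, hAp'⟩
  · obtain ⟨p', hAp'⟩ := hA' 0
    obtain ⟨h, hh, hp'⟩ := havoid (g + c + 0) p'
    obtain ⟨p, hp, hAp⟩ := hA (g + c + 0 + h)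
    exact ⟨c, hc, 0, by omega, h, hh, p, p', hp, hp', hAp, hAp'⟩
  · obtain ⟨p, hAp⟩ := hA 0
    obtain ⟨h, hh, hp⟩ := havoid (g + 0 + c') p
    obtain ⟨p', hp', hAp'⟩ := hA' (g + 0 + c' + h)
    exact ⟨0, by omega, c', hc', h, hh, p, p', hp, hp', hAp, hAp'⟩
  · choose α hα using hA
    choose α' hα' using hA'
    suffices h : ∃ c ≤ 1, ∃ c' ≤ 1, ∃ h ≤ 1, α c ≠ g + c + c' + h ∧ α' c' ≠ g + c + c' + h by
      obtain ⟨c, hc, c', hc', h, hh, h1, h2⟩ := h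
      exact ⟨c, hc, c', hc', h, hh, α c, α' c', h1, h2, hα c, hα' c'⟩
    by_contra hcon
    push Not at hcon
    have h00 := hcon 0 (by omega) 0 (by omega) 0 (by omega)
    have h01 := hcon 0 (by omega) 0 (by omega) 1 (by omega)
    have h10 := hcon 0 (by omega) 1 (by omega) 0 (by omega)
    have h11 := hcon 0 (by omega) 1 (by omega) 1 (by omega)
    have h20 := hcon 1 (by omega) 0 (by omega) 0 (by omega)
    have h21 := hcon 1 (by omega) 0 (by omega) 1 (by omega)
    have h30 := hcon 1 (by omega) 1 (by omega) 0 (by omega)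
    have h31 := hcon 1 (by omega) 1 (by omega) 1 (by omega)
    clear hcon
    omega

/-- A centre with three rays and values starting at `4`. An end vertex with two admissible colours
for some raise never obstructs that raise, which leaves two rays; if there is no such end vertex,
all end vertices can take colours `≥ 5` at raise `0`, and the centre takes `4`. -/
theorem exists_raise_three (A₁ A₂ A₃ : ℕ → ℕ → Prop)
    (h₁ : (∃ c ≤ 1, ∀ f, ∃ p, p ≠ f ∧ A₁ c p) ∨ ∀ c, ∃ p, 5 ≤ p ∧ A₁ c p)
    (h₂ : (∃ c ≤ 1, ∀ f, ∃ p, p ≠ f ∧ A₂ c p) ∨ ∀ c, ∃ p, 5 ≤ p ∧ A₂ c p)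
    (h₃ : (∃ c ≤ 1, ∀ f, ∃ p, p ≠ f ∧ A₃ c p) ∨ ∀ c, ∃ p, 5 ≤ p ∧ A₃ c p) :
    ∃ c₁ ≤ 1, ∃ c₂ ≤ 1, ∃ c₃ ≤ 1, ∃ h ≤ 1, ∃ p₁ p₂ p₃, p₁ ≠ 4 + (c₁ + (c₂ + c₃)) + h ∧
      p₂ ≠ 4 + (c₁ + (c₂ + c₃)) + h ∧ p₃ ≠ 4 + (c₁ + (c₂ + c₃)) + h ∧
      A₁ c₁ p₁ ∧ A₂ c₂ p₂ ∧ A₃ c₃ p₃ := by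
  have weaken : ∀ A : ℕ → ℕ → Prop,
      ((∃ c ≤ 1, ∀ f, ∃ p, p ≠ f ∧ A c p) ∨ ∀ c, ∃ p, 5 ≤ p ∧ A c p) →
      ((∃ c ≤ 1, ∀ f, ∃ p, p ≠ f ∧ A c p) ∨ ∀ c, ∃ p, A c p) := fun A h =>
    h.imp_right fun h c => (h c).imp fun _ h => h.2
  rcases h₁ with ⟨c₁, hc₁, hA₁⟩ | hA₁
  · obtain ⟨c₂, hc₂, c₃, hc₃, h, hh, p₂, p₃, hp₂, hp₃, hA₂, hA₃⟩ :=
      exists_raise_two (4 + c₁) A₂ A₃ (weaken _ h₂) (weaken _ h₃)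
    obtain ⟨p₁, hp₁, hA₁⟩ := hA₁ (4 + (c₁ + (c₂ + c₃)) + h)
    exact ⟨c₁, hc₁, c₂, hc₂, c₃, hc₃, h, hh, p₁, p₂, p₃, hp₁, by omega, by omega, hA₁, hA₂, hA₃⟩
  rcases h₂ with ⟨c₂, hc₂, hA₂⟩ | hA₂
  · obtain ⟨c₁, hc₁, c₃, hc₃, h, hh, p₁, p₃, hp₁, hp₃, hA₁, hA₃⟩ :=
      exists_raise_two (4 + c₂) A₁ A₃ (weaken _ (Or.inr hA₁)) (weaken _ h₃)
    obtain ⟨p₂, hp₂, hA₂⟩ := hA₂ (4 + (c₁ + (c₂ + c₃)) + h)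
    exact ⟨c₁, hc₁, c₂, hc₂, c₃, hc₃, h, hh, p₁, p₂, p₃, by omega, hp₂, by omega, hA₁, hA₂, hA₃⟩
  rcases h₃ with ⟨c₃, hc₃, hA₃⟩ | hA₃
  · obtain ⟨c₁, hc₁, c₂, hc₂, h, hh, p₁, p₂, hp₁, hp₂, hA₁, hA₂⟩ :=
      exists_raise_two (4 + c₃) A₁ A₂ (weaken _ (Or.inr hA₁)) (weaken _ (Or.inr hA₂))
    obtain ⟨p₃, hp₃, hA₃⟩ := hA₃ (4 + (c₁ + (c₂ + c₃)) + h)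
    exact ⟨c₁, hc₁, c₂, hc₂, c₃, hc₃, h, hh, p₁, p₂, p₃, by omega, by omega, hp₃, hA₁, hA₂, hA₃⟩
  obtain ⟨p₁, hp₁, hA₁⟩ := hA₁ 0
  obtain ⟨p₂, hp₂, hA₂⟩ := hA₂ 0
  obtain ⟨p₃, hp₃, hA₃⟩ := hA₃ 0
  exact ⟨0, by omega, 0, by omega, 0, by omega, 0, by omega, p₁, p₂, p₃, by omega, by omega,
    by omega, hA₁, hA₂, hA₃⟩

variable {V : Type u} [Fintype V] {G : SimpleGraph V}

/-! ### Vertices of small degree, `β`-vertices and `β'`-vertices -/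

theorem eq_of_adj_of_deg_eq_one {l m x : V} (hl : deg G l = 1) (hm : G.Adj l m) (hx : G.Adj l x) :
    x = m := by
  have h1 : (G.neighborFinset l).card ≤ 1 := by
    rw [SimpleGraph.card_neighborFinset_eq_degree]; exact hl.le
  exact Finset.card_le_one.1 h1 x (by simpa using hx) m (by simpa using hm)

theorem two_le_deg {l m x : V} (hm : G.Adj l m) (hx : G.Adj l x) (h : x ≠ m) : 2 ≤ deg G l := by
  by_contra hcon
  have h1 : (G.neighborFinset l).card ≤ 1 := by
    rw [SimpleGraph.card_neighborFinset_eq_degree]; unfold deg at hcon; omega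
  exact h (Finset.card_le_one.1 h1 x (by simpa using hx) m (by simpa using hm))

theorem eq_or_eq_of_deg_two {l m m' x : V} (hl : deg G l ≤ 2) (hm : G.Adj l m) (hm' : G.Adj l m')
    (hne : m ≠ m') (hx : G.Adj l x) : x = m ∨ x = m' := by
  by_contra hcon
  push Not at hcon
  have h1 : ({x, m, m'} : Finset V) ⊆ G.neighborFinset l := by
    intro y hy
    simp only [mem_insert, mem_singleton] at hy
    rcases hy with rfl | rfl | rfl <;> simpa
  have h2 := Finset.card_le_card h1
  rw [SimpleGraph.card_neighborFinset_eq_degree, Finset.card_eq_three.2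
    ⟨x, m, m', hcon.1, hcon.2, hne, rfl⟩] at h2
  unfold deg at hl
  omega

/-- A neighbour `l` of `m` with degree at most `2` sees at most one colour besides that of `m`. If
there is no further neighbour, `q` is arbitrary. -/
theorem exists_color_of_deg_le_two {l m : V} (hl : deg G l ≤ 2) (h : G.Adj m l) (β : V → ℕ) :
    ∃ q, ∀ x, G.Adj l x → x ≠ m → β x = q := by
  have h1 : ((G.neighborFinset l).erase m).card ≤ 1 := by
    rw [Finset.card_erase_of_mem (by simpa using h.symm),
      SimpleGraph.card_neighborFinset_eq_degree]
    unfold deg at hl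
    omega
  obtain ⟨q, hq⟩ := exists_color_of_card_le_one h1 β
  exact ⟨q, fun x hx hxm => hq x (by simp [hx, hxm])⟩

theorem IsBeta.exists_two {v : V} (h : IsBeta G v) : ∃ u, G.Adj v u ∧ deg G u = 2 := by
  obtain ⟨u, hu⟩ := Finset.card_pos.1 (Nat.lt_of_lt_of_eq one_pos h.2.1.symm)
  exact ⟨u, by simpa using hu⟩

theorem IsBeta'.ne_two {v x : V} (h : IsBeta' G v) (hx : G.Adj v x) : deg G x ≠ 2 := by
  obtain ⟨k, -, -, -, h0⟩ := h
  intro hx2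
  have : x ∈ ((G.neighborFinset v).filter fun u => deg G u = 2) := by simp [hx, hx2]
  rw [Finset.card_eq_zero.1 h0] at this
  simp at this

theorem IsBeta'.exists_leaf {v : V} (h : IsBeta' G v) (hd : deg G v = 4) :
    ∃ l, G.Adj v l ∧ deg G l = 1 := by
  obtain ⟨k, -, hk, h1, -⟩ := h
  have hk2 : k - 1 = 1 := by omega
  obtain ⟨l, hl⟩ := Finset.card_pos.1 (Nat.lt_of_lt_of_eq one_pos (h1.trans hk2).symm)
  exact ⟨l, by simpa using hl⟩

/-! ### Raising weights inside a set of vertices -/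

/-- Deleting the edges inside `T` gives a proper subgraph, hence a proper weighting of it. Resetting
all weights on vertices of `T` and on edges inside `T` to `1` gives a weighting `w` of `G` such that
every raise by `0` or `1` of these weights creates a conflict at a vertex of `T`. -/
theorem exists_base_weighting (hG : IsMinimalTwoBad G) (T : Finset V)
    (hT : ∃ x ∈ T, ∃ y ∈ T, G.Adj x y) :
    ∃ w : Weighting V, IsTotalWeighting G 2 w ∧ (∀ x ∈ T, w.vertex x = 1) ∧
      (∀ x ∈ T, ∀ y ∈ T, w.edge s(x, y) = 1) ∧
      ∀ (g : Sym2 V → ℕ) (h : V → ℕ), (∀ e, g e ≤ 1) → (∀ x, h x ≤ 1) →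
        (∀ x y, g s(x, y) ≠ 0 → x ∈ T ∧ y ∈ T) → (∀ x, h x ≠ 0 → x ∈ T) →
        ∃ x ∈ T, ∃ y, G.Adj x y ∧
          color G w x + h x + ∑ z ∈ G.neighborFinset x, g s(x, z) =
          color G w y + h y + ∑ z ∈ G.neighborFinset y, g s(y, z) := by
  let H : G.Subgraph :=
    { verts := Set.univ
      Adj := fun x y => G.Adj x y ∧ ¬ (x ∈ T ∧ y ∈ T)
      adj_sub := fun h => h.1
      edge_vert := fun _ => trivial
      symm := ⟨fun x y h => ⟨h.1.symm, fun h' => h.2 ⟨h'.2, h'.1⟩⟩⟩ }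
  have hH : H ≠ ⊤ := by
    intro h
    obtain ⟨x, hx, y, hy, hxy⟩ := hT
    have : H.Adj x y := by rw [h]; exact hxy
    exact this.2 ⟨hx, hy⟩
  have := hG.2 H hH
  unfold IsTwoBad at this
  push Not at this
  obtain ⟨w, ⟨hwv, hwe⟩, hwp⟩ := this
  let i : V → H.verts := fun x => ⟨x, trivial⟩
  let w₁ : Weighting V :=
    { vertex := fun x => if x ∈ T then 1 else w.vertex (i x)
      edge := fun e => if ∀ x ∈ e, x ∈ T then 1 else w.edge (e.map i) }
  have hw₁e : ∀ x ∈ T, ∀ y ∈ T, w₁.edge s(x, y) = 1 := by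
    intro x hx y hy
    simp [w₁, hx, hy]
  have hw₁ : IsTotalWeighting G 2 w₁ := by
    refine ⟨fun x => ?_, fun e => ?_⟩
    · by_cases hx : x ∈ T
      · simp [w₁, hx]
      · simpa [w₁, hx] using hwv (i x)
    · induction e with | _ x y
      intro he
      by_cases hxy : x ∈ T ∧ y ∈ T
      · rw [hw₁e x hxy.1 y hxy.2]; simp
      · have h1 : w₁.edge s(x, y) = w.edge s(i x, i y) := by simp [w₁, hxy]
        rw [h1]
        exact hwe _ (show H.Adj x y from ⟨he, hxy⟩)
  -- A vertex outside `T` loses no edge, so it sees the same total in `G` and in the subgraph.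
  have hcol : ∀ x, x ∉ T → color G w₁ x = color H.coe w (i x) := by
    intro x hx
    unfold color
    congr 1
    · simp [w₁, hx]
    · refine Finset.sum_bij (fun y _ => i y) ?_ ?_ ?_ ?_
      · intro y hy
        simp only [SimpleGraph.mem_neighborFinset] at hy ⊢
        exact ⟨hy, fun h => hx h.1⟩
      · intro a _ b _ hab
        exact congrArg Subtype.val hab
      · intro b hb
        simp only [SimpleGraph.mem_neighborFinset] at hb
        exact ⟨b.1, by simpa using hb.1, rfl⟩
      · intro y _
        simp [w₁, hx]
  refine ⟨w₁, hw₁, fun x hx => by simp [w₁, hx], hw₁e, ?_⟩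
  intro g h hg hh hgT hhT
  let w₂ : Weighting V :=
    { vertex := fun x => w₁.vertex x + h x
      edge := fun e => w₁.edge e + g e }
  have hcol₂ : ∀ x, color G w₂ x =
      color G w₁ x + h x + ∑ z ∈ G.neighborFinset x, g s(x, z) := by
    intro x
    simp only [color, w₂, Finset.sum_add_distrib]
    ring
  have hcol₃ : ∀ x, x ∉ T → color G w₂ x = color H.coe w (i x) := by
    intro x hx
    have h0 : h x = 0 := by by_contra h0; exact hx (hhT x h0)
    have h1 : ∑ z ∈ G.neighborFinset x, g s(x, z) = 0 :=
      Finset.sum_eq_zero fun z _ => by by_contra h1; exact hx (hgT x z h1).1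
    rw [hcol₂, hcol x hx, h0, h1]; rfl
  have hw₂ : IsTotalWeighting G 2 w₂ := by
    refine ⟨fun x => ?_, fun e => ?_⟩
    · have h1 := hw₁.1 x
      have h2 := hh x
      by_cases hx : x ∈ T
      · have h3 : w₁.vertex x = 1 := by simp [w₁, hx]
        simp only [w₂, Finset.mem_Icc, h3]; omega
      · have h0 : h x = 0 := by by_contra h0; exact hx (hhT x h0)
        simpa [w₂, h0] using h1
    · induction e with | _ x y
      intro he
      have h1 := hw₁.2 _ he
      have h2 := hg s(x, y)
      by_cases hx : x ∈ T ∧ y ∈ T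
      · have h3 := hw₁e x hx.1 y hx.2
        simp only [w₂, Finset.mem_Icc, h3]; omega
      · have h0 : g s(x, y) = 0 := by by_contra h0; exact hx (hgT x y h0)
        simpa [w₂, h0] using h1
  have h2 : ¬ IsProper G w₂ := fun h => hG.1 ⟨w₂, hw₂, h⟩
  unfold IsProper at h2
  push Not at h2
  obtain ⟨x, y, hxy, he⟩ := h2
  by_cases hx : x ∈ T
  · exact ⟨x, hx, y, hxy, by rw [← hcol₂, ← hcol₂, he]⟩
  by_cases hy : y ∈ T
  · exact ⟨y, hy, x, hxy.symm, by rw [← hcol₂, ← hcol₂, he]⟩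
  exfalso
  rw [hcol₃ x hx, hcol₃ y hy] at he
  exact hwp (i x) (i y) ⟨hxy, fun h => hx h.1⟩ (by convert he)

/-- The neighbours of the core vertex `m` outside the core `M` and outside its set `L m` of
pendants. Their colours stay fixed when weights are raised. -/
noncomputable def outer (G : SimpleGraph V) (M : Finset V) (L : V → Finset V) (m : V) : Finset V :=
  (G.neighborFinset m).filter fun y => y ∉ M ∧ y ∉ L m

/-- The colour `p` is available to the core vertex `m` of initial colour `β m`, given that the edges
from `m` to other core vertices are raised by `c` in total: raising the weight of `m` by `h` and the
edges to its pendants `l ∈ L m` by `b l` produces `p`, no neighbour in `outer G M L m` has colour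
`p`, and the weight of each pendant can be raised by some `e` so that it differs in colour from all
its neighbours. The last condition is local because the neighbours of a pendant `l ∈ L m` other
than `m` keep their colours. -/
def Avail (G : SimpleGraph V) (M : Finset V) (L : V → Finset V) (β : V → ℕ) (m : V) (c p : ℕ) :
    Prop :=
  ∃ h ≤ 1, ∃ b : V → ℕ, (∀ l, b l ≤ 1) ∧ p = β m + c + h + ∑ l ∈ L m, b l ∧
    (∀ y ∈ outer G M L m, p ≠ β y) ∧
    ∀ l ∈ L m, ∃ e ≤ 1, β l + b l + e ≠ p ∧ ∀ x, G.Adj l x → x ≠ m → β l + b l + e ≠ β x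

/-- Let `M` be a set of core vertices, each `m ∈ M` with a set `L m` of pendant neighbours whose
other neighbours are neither in the core nor pendants. In a minimal 2-bad graph there are initial
colours `β`, arising from weights `1` on everything inside the core and its pendants, such that no
choice of raises `f` of the edges of the core and of available colours `p` is proper on the core.
The bounds on `β` come from the edge weights `1` inside and `1` or `2` outside. -/
theorem exists_base_core (hG : IsMinimalTwoBad G) (M : Finset V) (L : V → Finset V)
    (hadj : ∀ m ∈ M, ∀ l ∈ L m, G.Adj m l) (hLM : ∀ m ∈ M, ∀ l ∈ L m, l ∉ M)
    (hlow : ∀ m ∈ M, ∀ l ∈ L m, ∀ x, G.Adj l x → x ≠ m → x ∉ M ∧ ∀ m' ∈ M, x ∉ L m')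
    (hne : (∃ m ∈ M, (L m).Nonempty) ∨ ∃ m ∈ M, ∃ m' ∈ M, G.Adj m m') :
    ∃ β : V → ℕ,
      (∀ m ∈ M, deg G m + 1 ≤ β m ∧ β m ≤ deg G m + 1 + (outer G M L m).card) ∧
      (∀ m ∈ M, ∀ l ∈ L m, deg G l + 1 ≤ β l ∧ β l ≤ 2 * deg G l) ∧
      (∀ y, y ∉ M → (∀ m ∈ M, y ∉ L m) → deg G y + 1 ≤ β y) ∧
      ∀ (f : Sym2 V → ℕ) (p : V → ℕ), (∀ e, f e ≤ 1) →
        (∀ m ∈ M, Avail G M L β m (∑ m' ∈ M with G.Adj m m', f s(m, m')) (p m)) →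
        ∃ m ∈ M, ∃ m' ∈ M, G.Adj m m' ∧ p m = p m' := by
  set T : Finset V := M ∪ M.biUnion L with hTdef
  have hMT : ∀ m ∈ M, m ∈ T := fun m hm => Finset.mem_union_left _ hm
  have hLT : ∀ m ∈ M, ∀ l ∈ L m, l ∈ T := fun m hm l hl =>
    Finset.mem_union_right _ (Finset.mem_biUnion.2 ⟨m, hm, hl⟩)
  have hTM : ∀ x ∈ T, x ∈ M ∨ ∃ m ∈ M, x ∈ L m := by
    intro x hx
    simpa [hTdef] using hx
  have howner : ∀ m ∈ M, ∀ l ∈ L m, ∀ m' ∈ M, G.Adj l m' → m' = m := by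
    intro m hm l hl m' hm' hlm'
    by_contra hne
    exact (hlow m hm l hl m' hlm' hne).1 hm'
  have hTe : ∃ x ∈ T, ∃ y ∈ T, G.Adj x y := by
    rcases hne with ⟨m, hm, l, hl⟩ | ⟨m, hm, m', hm', h⟩
    · exact ⟨m, hMT m hm, l, hLT m hm l hl, hadj m hm l hl⟩
    · exact ⟨m, hMT m hm, m', hMT m' hm', h⟩
  obtain ⟨w, ⟨hwv, hwe⟩, hv1, he1, hw⟩ := exists_base_weighting hG T hTe
  have hwe' : ∀ x y, G.Adj x y → 1 ≤ w.edge s(x, y) ∧ w.edge s(x, y) ≤ 2 := by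
    intro x y hxy
    simpa using hwe s(x, y) hxy
  have hlb : ∀ x, deg G x + 1 ≤ color G w x := by
    intro x
    have h1 : (G.neighborFinset x).card • 1 ≤ ∑ u ∈ G.neighborFinset x, w.edge s(x, u) :=
      Finset.card_nsmul_le_sum _ _ _ fun u hu => (hwe' x u (by simpa using hu)).1
    have h2 := hwv x
    simp only [Finset.mem_Icc] at h2
    simp only [smul_eq_mul, mul_one, SimpleGraph.card_neighborFinset_eq_degree] at h1
    unfold color deg
    omega
  have hub : ∀ x ∈ T, color G w x ≤
      deg G x + 1 + ((G.neighborFinset x).filter fun y => y ∉ T).card := by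
    intro x hx
    have h1 : ∑ u ∈ G.neighborFinset x, w.edge s(x, u) ≤
        ∑ u ∈ G.neighborFinset x, (1 + if u ∉ T then 1 else 0) := by
      refine Finset.sum_le_sum fun u hu => ?_
      by_cases hu' : u ∈ T
      · simp [he1 x hx u hu', hu']
      · simpa [hu'] using (hwe' x u (by simpa using hu)).2
    rw [Finset.sum_add_distrib, ← Finset.card_filter] at h1
    simp only [Finset.sum_const, smul_eq_mul, mul_one,
      SimpleGraph.card_neighborFinset_eq_degree] at h1
    unfold color deg
    rw [hv1 x hx]
    omega
  refine ⟨color G w, fun m hm => ⟨hlb m, (hub m (hMT m hm)).trans ?_⟩,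
    fun m hm l hl => ⟨hlb l, (hub l (hLT m hm l hl)).trans ?_⟩, fun y _ _ => hlb y, ?_⟩
  · refine Nat.add_le_add_left (Finset.card_le_card fun y hy => ?_) _
    simp only [Finset.mem_filter, outer] at hy ⊢
    exact ⟨hy.1, fun h => hy.2 (hMT y h), fun h => hy.2 (hLT m hm y h)⟩
  · have h1 : (G.neighborFinset l).filter (fun y => y ∉ T) ⊆ (G.neighborFinset l).erase m := by
      intro y hy
      simp only [Finset.mem_filter] at hy
      exact Finset.mem_erase.2 ⟨fun h => hy.2 (h ▸ hMT m hm), hy.1⟩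
    have h2 := Finset.card_le_card h1
    have h3 : m ∈ G.neighborFinset l := by simpa using (hadj m hm l hl).symm
    rw [Finset.card_erase_of_mem h3] at h2
    have h4 := Finset.card_pos.2 ⟨m, h3⟩
    simp only [SimpleGraph.card_neighborFinset_eq_degree] at h2 h4
    unfold deg
    omega
  intro f p hf hp
  unfold Avail at hp
  choose! h hh b hb hpe hpo e he1' he2 he3 using hp
  -- The edge raises: `f` between core vertices, `b m l` between `m` and its pendant `l`.
  let g : Sym2 V → ℕ := Sym2.lift ⟨fun x y => if x ∈ M ∧ y ∈ M then f s(x, y) else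
    (if x ∈ M ∧ y ∈ L x then b x y else if y ∈ M ∧ x ∈ L y then b y x else 0), by
      intro x y
      by_cases h1 : x ∈ M <;> by_cases h2 : y ∈ M
      · simp [h1, h2, Sym2.eq_swap]
      · simp [h1, h2]
      · simp [h1, h2]
      · simp [h1, h2]⟩
  have hgMM : ∀ x ∈ M, ∀ y ∈ M, g s(x, y) = f s(x, y) := by
    intro x hx y hy; simp [g, hx, hy]
  have hgML : ∀ x ∈ M, ∀ y ∈ L x, g s(x, y) = b x y := by
    intro x hx y hy; simp [g, hx, hy, hLM x hx y hy]
  have hg0 : ∀ x y, (¬ (x ∈ M ∧ y ∈ M)) → (¬ (x ∈ M ∧ y ∈ L x)) → (¬ (y ∈ M ∧ x ∈ L y)) →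
      g s(x, y) = 0 := by
    intro x y h1 h2 h3; simp [g, h1, h2, h3]
  -- The vertex raises; the sum has one term, because a pendant belongs to only one core vertex.
  let k : V → ℕ := fun x => if x ∈ M then h x else ∑ m ∈ M with x ∈ L m, e m x
  have hkM : ∀ m ∈ M, k m = h m := fun m hm => by simp [k, hm]
  have hkL : ∀ m ∈ M, ∀ l ∈ L m, k l = e m l := by
    intro m hm l hl
    have : ({m' ∈ M | l ∈ L m'} : Finset V) = {m} := by
      ext m'
      simp only [Finset.mem_filter, Finset.mem_singleton]
      constructor
      · rintro ⟨h1, h2⟩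
        exact howner m hm l hl m' h1 (hadj m' h1 l h2).symm
      · rintro rfl; exact ⟨hm, hl⟩
    simp [k, hLM m hm l hl, this]
  have hk0 : ∀ x, x ∉ T → k x = 0 := by
    intro x hx
    have : ({m' ∈ M | x ∈ L m'} : Finset V) = ∅ := by
      ext m'
      simp only [Finset.mem_filter, Finset.notMem_empty, iff_false]
      exact fun h => hx (hLT m' h.1 x h.2)
    have hxM : x ∉ M := fun h => hx (hMT x h)
    simp [k, this, hxM]
  have hgT : ∀ x y, g s(x, y) ≠ 0 → x ∈ T ∧ y ∈ T := by
    intro x y hxy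
    by_contra hcon
    apply hxy
    apply hg0
    · exact fun h => hcon ⟨hMT x h.1, hMT y h.2⟩
    · exact fun h => hcon ⟨hMT x h.1, hLT x h.1 y h.2⟩
    · exact fun h => hcon ⟨hLT y h.1 x h.2, hMT y h.1⟩
  have hg1 : ∀ e, g e ≤ 1 := by
    intro e
    induction e with | _ x y
    simp only [g, Sym2.lift_mk]
    split_ifs with h1 h2 h3
    · exact hf _
    · exact hb x h2.1 y
    · exact hb y h3.1 x
    · simp
  have hk1 : ∀ x, k x ≤ 1 := by
    intro x
    by_cases hx : x ∈ T
    · rcases hTM x hx with hm | ⟨m, hm, hl⟩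
      · rw [hkM x hm]; exact hh x hm
      · rw [hkL m hm x hl]; exact he1' m hm x hl
    · rw [hk0 x hx]; simp
  have hcM : ∀ m ∈ M, color G w m + k m + ∑ z ∈ G.neighborFinset m, g s(m, z) = p m := by
    intro m hm
    have h1 : ∑ z ∈ G.neighborFinset m, g s(m, z) =
        ∑ m' ∈ M with G.Adj m m', f s(m, m') + ∑ l ∈ L m, b m l := by
      rw [← Finset.sum_subset (s₁ := {m' ∈ M | G.Adj m m'} ∪ L m)]
      · rw [Finset.sum_union]
        · congr 1
          · refine Finset.sum_congr rfl fun y hy => ?_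
            exact hgMM m hm y (Finset.mem_filter.1 hy).1
          · exact Finset.sum_congr rfl fun y hy => hgML m hm y hy
        · rw [Finset.disjoint_left]
          intro y hy hy'
          exact hLM m hm y hy' (Finset.mem_filter.1 hy).1
      · intro y hy
        rcases Finset.mem_union.1 hy with hy | hy
        · simpa using (Finset.mem_filter.1 hy).2
        · simpa using hadj m hm y hy
      · intro y hy hy'
        simp only [SimpleGraph.mem_neighborFinset] at hy
        simp only [Finset.mem_union, Finset.mem_filter, not_or, not_and] at hy'
        apply hg0
        · exact fun h => hy'.1 h.2 hy
        · exact fun h => hy'.2 h.2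
        · rintro ⟨h1, -⟩
          exact hy'.1 h1 hy
    rw [hkM m hm, h1, hpe m hm]
    ring
  have hcL : ∀ m ∈ M, ∀ l ∈ L m,
      color G w l + k l + ∑ z ∈ G.neighborFinset l, g s(l, z) = color G w l + b m l + e m l := by
    intro m hm l hl
    have h1 : ∑ z ∈ G.neighborFinset l, g s(l, z) = b m l := by
      rw [Finset.sum_eq_single m]
      · rw [Sym2.eq_swap, hgML m hm l hl]
      · intro y hy hym
        have h2 := hlow m hm l hl y (by simpa using hy) hym
        apply hg0
        · exact fun h => h2.1 h.2
        · exact fun h => hLM m hm l hl h.1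
        · exact fun h => h2.1 h.1
      · intro h; exact absurd (by simpa using (hadj m hm l hl).symm) h
    rw [hkL m hm l hl, h1]
    ring
  have hcO : ∀ y, y ∉ T →
      color G w y + k y + ∑ z ∈ G.neighborFinset y, g s(y, z) = color G w y := by
    intro y hy
    have h1 : ∑ z ∈ G.neighborFinset y, g s(y, z) = 0 :=
      Finset.sum_eq_zero fun z _ => by by_contra h1; exact hy (hgT y z h1).1
    rw [hk0 y hy, h1, add_zero, add_zero]
  obtain ⟨x, hx, y, hxy, heq⟩ := hw g k hg1 hk1 hgT (fun x hx => by
    by_contra h1; exact hx (hk0 x h1))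
  rcases hTM x hx with hxM | ⟨m, hm, hl⟩
  · rw [hcM x hxM] at heq
    by_cases hyT : y ∈ T
    · rcases hTM y hyT with hyM | ⟨m, hm, hl⟩
      · rw [hcM y hyM] at heq
        exact ⟨x, hxM, y, hyM, hxy, heq⟩
      · obtain rfl := howner m hm y hl x hxM hxy.symm
        rw [hcL x hm y hl] at heq
        exact (he2 x hm y hl heq.symm).elim
    · rw [hcO y hyT] at heq
      exact (hpo x hxM y (Finset.mem_filter.2 ⟨by simpa using hxy, fun h => hyT (hMT y h),
        fun h => hyT (hLT x hxM y h)⟩) heq).elim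
  · rw [hcL m hm x hl] at heq
    by_cases hym : y = m
    · subst hym
      rw [hcM y hm] at heq
      exact (he2 y hm x hl heq).elim
    · have h2 := hlow m hm x hl y hxy hym
      have hyT : y ∉ T := by
        intro h
        rcases hTM y h with h | ⟨m', h, h'⟩
        · exact h2.1 h
        · exact h2.2 m' h h'
      rw [hcO y hyT] at heq
      exact (he3 m hm x hl y hxy hym heq).elim

/-! ### Colours available to a core vertex -/

theorem card_outer {M : Finset V} {L : V → Finset V} {m : V} (hadj : ∀ l ∈ L m, G.Adj m l)
    (hLM : ∀ l ∈ L m, l ∉ M) :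
    (outer G M L m).card + (M.filter (G.Adj m)).card + (L m).card = deg G m := by
  unfold deg
  rw [← SimpleGraph.card_neighborFinset_eq_degree,
    ← Finset.card_union_of_disjoint, ← Finset.card_union_of_disjoint]
  · congr 1
    ext y
    simp only [outer, mem_union, mem_filter, SimpleGraph.mem_neighborFinset]
    constructor
    · rintro ((h | h) | h)
      · exact h.1
      · exact h.2
      · exact hadj y h
    · tauto
  · rw [Finset.disjoint_left]
    intro y hy hl
    simp only [outer, mem_union, mem_filter] at hy
    rcases hy with hy | hy
    · exact hy.2.2 hl
    · exact hLM y hl hy.1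
  · rw [Finset.disjoint_left]
    intro y hy hl
    simp only [outer, mem_filter] at hy hl
    exact hy.2.1 hl.1

theorem Avail.of_eq_empty {M : Finset V} {L : V → Finset V} {β : V → ℕ} {m : V} {c p : ℕ}
    (hL : L m = ∅) (h : ℕ) (hh : h ≤ 1) (hp : p = β m + c + h)
    (hout : ∀ y ∈ outer G M L m, p ≠ β y) : Avail G M L β m c p :=
  ⟨h, hh, fun _ => 0, by simp, by simp [hL, hp], hout, by simp [hL]⟩

theorem Avail.of_eq_singleton {M : Finset V} {L : V → Finset V} {β : V → ℕ} {m l : V}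
    {c p q : ℕ} (hL : L m = {l}) (hq : ∀ x, G.Adj l x → x ≠ m → β x = q) (h b : ℕ) (hh : h ≤ 1)
    (hb : b ≤ 1) (hp : p = β m + c + h + b) (hout : ∀ y ∈ outer G M L m, p ≠ β y)
    (h1 : ¬ (p = β l + b ∧ q = β l + b + 1)) (h2 : ¬ (p = β l + b + 1 ∧ q = β l + b)) :
    Avail G M L β m c p := by
  refine ⟨h, hh, fun _ => b, fun _ => hb, by simp [hL, hp], hout, ?_⟩
  intro l' hl'
  obtain rfl : l' = l := by simpa [hL] using hl'
  obtain ⟨e, he, he1, he2⟩ := exists_raise_ne h1 h2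
  exact ⟨e, he, he1, fun x hx hxm => by rw [hq x hx hxm]; exact he2⟩

/-- A leaf never obstructs its neighbour, so all values reached by raising `m` and its pendant edges
are available up to the outer colours. -/
theorem Avail.of_leaves {M : Finset V} {L : V → Finset V} {m : V} {β : V → ℕ} {c : ℕ} (n : ℕ)
    (hL : ∀ l ∈ L m, ∀ x, G.Adj l x → x = m) (hn : n ≤ (L m).card + 1)
    (hout : ∀ y ∈ outer G M L m, β m + c + n ≠ β y) : Avail G M L β m c (β m + c + n) := by
  obtain ⟨b, hb, hbs, -⟩ := exists_sum_eq (L m) (n := n - min n 1) (by omega)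
  refine ⟨min n 1, by omega, b, hb, by omega, hout, ?_⟩
  intro l hl
  obtain ⟨e, he, he1, -⟩ := exists_raise_ne (B := β l) (b := b l) (p := β m + c + n)
    (q := β m + c + n) (by omega) (by omega)
  exact ⟨e, he, he1, fun x hx hxm => absurd (hL l hl x hx) hxm⟩

theorem exists_avail_of_leaves {M : Finset V} {L : V → Finset V} {m : V} (β : V → ℕ) (c : ℕ)
    (hL : ∀ l ∈ L m, ∀ x, G.Adj l x → x = m) (hcard : (outer G M L m).card ≤ (L m).card + 1) :
    ∃ p, β m ≤ p ∧ Avail G M L β m c p := by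
  obtain ⟨n, hn, hn'⟩ := exists_shift_ne (outer G M L m) β (β m + c) _ hcard
  exact ⟨β m + c + n, by omega, Avail.of_leaves n hL hn hn'⟩

/-- The colour of a pendant of degree at most `2` is at most `5` plus the raise of its edge to
`m`, so a larger colour of `m` never conflicts with it. The vertex `m` is raised before its edges:
with `n ≤ 1` all pendant edges keep weight `1`, and colour `6` is large enough. -/
theorem Avail.of_large {M : Finset V} {L : V → Finset V} {β : V → ℕ} {m : V} {c : ℕ} (n : ℕ)
    (hadj : ∀ l ∈ L m, G.Adj m l) (hdeg : ∀ l ∈ L m, deg G l ≤ 2)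
    (hβ : ∀ l ∈ L m, β l ≤ 2 * deg G l)
    (hn : n ≤ (L m).card + 1) (h6 : 6 ≤ β m + c + n) (h7 : 2 ≤ n → 7 ≤ β m + c + n)
    (hout : ∀ y ∈ outer G M L m, β m + c + n ≠ β y) : Avail G M L β m c (β m + c + n) := by
  obtain ⟨b, hb, hbs, hb0⟩ := exists_sum_eq (L m) (n := n - min n 1) (by omega)
  refine ⟨min n 1, by omega, b, hb, by omega, hout, fun l hl => ?_⟩
  have h1 := hdeg l hl
  have h2 := hβ l hl
  -- The largest colour of `l` is below that of `m`, so only its other neighbour matters.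
  have h3 : b l + 5 < β m + c + n := by
    have h4 := hb l
    by_cases h : 2 ≤ n
    · have := h7 h; omega
    · rw [hb0 (by omega)]; simp only [Pi.zero_apply]; omega
  obtain ⟨q, hq⟩ := exists_color_of_deg_le_two h1 (hadj l hl) β
  obtain ⟨e, he, he1, he2⟩ := exists_raise_ne (B := β l) (b := b l) (p := β m + c + n) (q := q)
    (by omega) (by omega)
  exact ⟨e, he, he1, fun x hx hxm => by rw [hq x hx hxm]; exact he2⟩

section BetaArm

variable {M : Finset V} {L : V → Finset V} {β : V → ℕ} {m l : V}

/-- The colours available to a core vertex which looks like a `β`-vertex: its pendant has degree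
`2`, it has at most one outer neighbour and one further edge, raised by `c`. The pendant never
blocks the middle one of the three values (there are two ways to reach it), and it blocks at most
one extreme value if `c = 1`. If only one colour is left for `c = 1`, the pendant's other
neighbour has a colour which does no harm for `c = 0`, so two colours are left there. -/
theorem exists_avail_of_beta (hL : L m = {l}) (hadj : G.Adj m l) (hl : deg G l = 2)
    (hm : 4 ≤ β m ∧ β m ≤ 5) (hβl : 3 ≤ β l ∧ β l ≤ 4) (hout : (outer G M L m).card ≤ 1) :
    (∃ p, Avail G M L β m 1 p) ∧
      ∃ c ≤ 1, ∃ p p', p ≠ p' ∧ Avail G M L β m c p ∧ Avail G M L β m c p' := by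
  obtain ⟨Y, hY⟩ := exists_color_of_card_le_one hout β
  obtain ⟨q, hq⟩ := exists_color_of_deg_le_two hl.le hadj β
  have key : ∀ c h b : ℕ, h ≤ 1 → b ≤ 1 → β m + c + h + b ≠ Y →
      ¬ (β m + c + h + b = β l + b ∧ q = β l + b + 1) →
      ¬ (β m + c + h + b = β l + b + 1 ∧ q = β l + b) →
      Avail G M L β m c (β m + c + h + b) := fun c h b hh hb h0 h1 h2 =>
    Avail.of_eq_singleton hL hq h b hh hb rfl (fun y hy => by rw [hY y hy]; exact h0) h1 h2
  have key' : ∀ c p : ℕ, p ≠ Y ∧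
      (p = β m + c ∧ ¬ (p = β l ∧ q = β l + 1) ∧ ¬ (p = β l + 1 ∧ q = β l) ∨
       p = β m + c + 1 ∨
       p = β m + c + 2 ∧ ¬ (p = β l + 1 ∧ q = β l + 2) ∧ ¬ (p = β l + 2 ∧ q = β l + 1)) →
      Avail G M L β m c p := by
    rintro c p ⟨hpY, ⟨rfl, h1, h2⟩ | rfl | ⟨rfl, h1, h2⟩⟩
    · exact key c 0 0 (by omega) (by omega) hpY h1 h2
    · by_cases h1 : ¬ (β m + c + 1 = β l ∧ q = β l + 1) ∧ ¬ (β m + c + 1 = β l + 1 ∧ q = β l)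
      · exact key c 1 0 (by omega) (by omega) hpY h1.1 h1.2
      · exact key c 0 1 (by omega) (by omega) hpY (by omega) (by omega)
    · exact key c 1 1 (by omega) (by omega) hpY h1 h2
  constructor
  · by_contra hcon
    push Not at hcon
    have h0 := mt (key' 1 (β m + 1)) (hcon _)
    have h1 := mt (key' 1 (β m + 1 + 1)) (hcon _)
    have h2 := mt (key' 1 (β m + 1 + 2)) (hcon _)
    omega
  · by_contra hcon
    push Not at hcon
    have H : ∀ c ≤ 1, ∀ p p', p ≠ p' → ¬ (_ ∧ _) := fun c hc p p' hne h =>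
      hcon c hc p p' hne (key' c p h.1) (key' c p' h.2)
    have a1 := H 1 le_rfl (β m + 1) (β m + 2) (by omega)
    have a2 := H 1 le_rfl (β m + 1) (β m + 3) (by omega)
    have a3 := H 1 le_rfl (β m + 2) (β m + 3) (by omega)
    have b1 := H 0 (by omega) (β m) (β m + 1) (by omega)
    have b2 := H 0 (by omega) (β m) (β m + 2) (by omega)
    have b3 := H 0 (by omega) (β m + 1) (β m + 2) (by omega)
    clear hcon H key key' hY hq
    generalize β m = B at *
    generalize β l = D at *
    have : B = 4 ∨ B = 5 := by omega
    have : D = 3 ∨ D = 4 := by omega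
    rcases ‹B = 4 ∨ B = 5› with rfl | rfl <;> rcases ‹D = 3 ∨ D = 4› with rfl | rfl <;>
      simp at a1 a2 a3 b1 b2 b3 <;> omega

end BetaArm

/-! ### Vertices with many neighbours of degree at most two -/

/-- The case of a core consisting of one vertex. -/
theorem exists_base_single (hG : IsMinimalTwoBad G) {v : V} {L : Finset V} (hL : L.Nonempty)
    (hadj : ∀ l ∈ L, G.Adj v l) (hlow : ∀ l ∈ L, ∀ l' ∈ L, ¬ G.Adj l l') :
    ∃ β : V → ℕ, (deg G v + 1 ≤ β v ∧ β v ≤ 2 * deg G v + 1 - L.card) ∧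
      (outer G {v} (fun _ => L) v).card + L.card = deg G v ∧
      (∀ l ∈ L, deg G l + 1 ≤ β l ∧ β l ≤ 2 * deg G l) ∧
      ∀ p, ¬ Avail G {v} (fun _ => L) β v 0 p := by
  have hvL : ∀ l ∈ L, l ∉ ({v} : Finset V) := by
    intro l hl h
    rw [mem_singleton] at h
    subst h
    exact G.irrefl (hadj l hl)
  obtain ⟨β, h1, h2, -, h3⟩ := exists_base_core hG {v} (fun _ => L)
    (by simpa using hadj) (by simpa using hvL)
    (by
      intro m hm l hl x hlx hxm
      rw [mem_singleton] at hm
      subst hm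
      exact ⟨by simpa using hxm, fun m' _ hx => hlow l hl x hx hlx⟩)
    (Or.inl ⟨v, by simp, hL⟩)
  have h4 : (({v} : Finset V).filter (G.Adj v)) = ∅ := by
    ext x; simp only [mem_filter, mem_singleton, notMem_empty, iff_false]
    rintro ⟨rfl, h⟩; exact G.irrefl h
  have h5 := card_outer (G := G) (M := {v}) (L := fun _ => L) (m := v) hadj hvL
  rw [h4] at h5
  have h6 := h1 v (by simp)
  simp only [card_empty] at h5
  refine ⟨β, ⟨h6.1, by omega⟩, by omega, fun l hl => h2 v (by simp) l hl, ?_⟩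
  intro p hp
  obtain ⟨m, hm, m', hm', h, -⟩ := h3 (fun _ => 0) (fun _ => p) (by simp) (by
    intro m hm
    rw [mem_singleton] at hm
    subst hm
    simpa using hp)
  rw [mem_singleton] at hm hm'
  subst hm hm'
  exact G.irrefl h

/-- The three values of the vertex avoid its at most two other neighbours, and the leaf does not
matter. -/
theorem isTwoReducible_configA : IsTwoReducible.{u} configA := by
  rintro V _ G hG ⟨v, u, hv, hvu, hu⟩
  obtain ⟨β, -, h2, -, h4⟩ := exists_base_single hG (v := v) (L := {u}) (by simp) (by simpa)
    (by simp)
  obtain ⟨p, -, hp⟩ := exists_avail_of_leaves (G := G) (M := {v}) (L := fun _ => {u}) (m := v) β 0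
    (by
      intro l hl x hx
      obtain rfl : l = u := by simpa using hl
      exact eq_of_adj_of_deg_eq_one hu hvu.symm hx)
    (by simp at h2 ⊢; omega)
  exact h4 p hp

/-- A minimal 2-bad graph has no triangle with two `2`-vertices. If the third vertex `v` has
degree at least `5`, its colour is at least `6` and recolouring the two `2`-vertices with small
colours suffices; otherwise `v` is recoloured as well. -/
theorem not_adj_of_deg_le_two (hG : IsMinimalTwoBad G) {v u u' : V} (hu : deg G u ≤ 2)
    (hu' : deg G u' ≤ 2) (hvu : G.Adj v u) (hvu' : G.Adj v u') : ¬ G.Adj u u' := by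
  intro huu'
  have n1 := hvu.ne
  have n2 := hvu'.ne
  have n3 := huu'.ne
  have hN : ∀ x, G.Adj u x → x = v ∨ x = u' := fun x hx =>
    eq_or_eq_of_deg_two hu hvu.symm huu' n2 hx
  have hN' : ∀ x, G.Adj u' x → x = v ∨ x = u := fun x hx =>
    eq_or_eq_of_deg_two hu' hvu'.symm huu'.symm n1 hx
  have d1 : deg G u = 2 := le_antisymm hu (two_le_deg hvu.symm huu' n2.symm)
  have d2 : deg G u' = 2 := le_antisymm hu' (two_le_deg hvu'.symm huu'.symm n1.symm)
  have d3 : 2 ≤ deg G v := two_le_deg hvu hvu' n3.symm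
  by_cases hd : 5 ≤ deg G v
  · obtain ⟨β, h1, -, h3, H⟩ := exists_base_core hG {u, u'} (fun _ => ∅) (by simp) (by simp)
      (by simp) (Or.inr ⟨u, by simp, u', by simp, huu'⟩)
    have hv := h3 v (by simp [n1, n2]) (by simp)
    have ho : ∀ x ∈ ({u, u'} : Finset V), ∀ y ∈ outer G {u, u'} (fun _ => ∅) x, y = v := by
      intro x hx y hy
      simp only [outer, mem_filter, SimpleGraph.mem_neighborFinset, mem_insert,
        mem_singleton, not_or] at hy hx
      rcases hx with rfl | rfl
      · exact (hN y hy.1).resolve_right hy.2.1.2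
      · exact (hN' y hy.1).resolve_right hy.2.1.1
    have ho' : ∀ x ∈ ({u, u'} : Finset V), (outer G {u, u'} (fun _ => ∅) x).card ≤ 1 := by
      intro x hx
      rw [Finset.card_le_one]
      intro a ha b hb
      rw [ho x hx a ha, ho x hx b hb]
    have b1 := h1 u (by simp)
    have b2 := h1 u' (by simp)
    have o1 := ho' u (by simp)
    have o2 := ho' u' (by simp)
    obtain ⟨h, hh, h', hh', hne⟩ : ∃ h ≤ 1, ∃ h' ≤ 1, β u + h ≠ β u' + h' ∧ β u + h < 6 ∧
        β u' + h' < 6 := by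
      by_cases h : β u = β u'
      · exact ⟨0, by omega, 1, by omega, by omega⟩
      · exact ⟨0, by omega, 0, by omega, by omega⟩
    obtain ⟨m, hm, m', hm', hmm, hp⟩ := H (fun _ => 0)
      (fun x => if x = u then β u + h else β u' + h') (by simp) (by
        intro m hm
        have hom := ho m hm
        simp only [mem_insert, mem_singleton] at hm
        rcases hm with rfl | rfl
        · refine Avail.of_eq_empty rfl h hh (by simp) ?_
          intro y hy
          rw [hom y hy]; simp; omega
        · refine Avail.of_eq_empty rfl h' hh' (by simp [n3.symm]) ?_
          intro y hy
          rw [hom y hy]; simp [n3.symm]; omega)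
    simp only [mem_insert, mem_singleton] at hm hm'
    rcases hm with rfl | rfl <;> rcases hm' with rfl | rfl <;>
      simp [n3.symm] at hmm hp <;> omega
  · obtain ⟨β, h1, -, -, H⟩ := exists_base_core hG {v, u, u'} (fun _ => ∅) (by simp) (by simp)
      (by simp) (Or.inr ⟨u, by simp, u', by simp, huu'⟩)
    have ho : outer G {v, u, u'} (fun _ => ∅) u = ∅ := by
      ext y
      simp only [outer, mem_filter, SimpleGraph.mem_neighborFinset, mem_insert,
        mem_singleton, not_or, notMem_empty, iff_false]
      rintro ⟨hy, h, -⟩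
      rcases hN y hy with rfl | rfl <;> simp at h
    have ho' : outer G {v, u, u'} (fun _ => ∅) u' = ∅ := by
      ext y
      simp only [outer, mem_filter, SimpleGraph.mem_neighborFinset, mem_insert,
        mem_singleton, not_or, notMem_empty, iff_false]
      rintro ⟨hy, h, -⟩
      rcases hN' y hy with rfl | rfl <;> simp at h
    have hov := card_outer (G := G) (M := {v, u, u'}) (L := fun _ => ∅) (m := v) (by simp) (by simp)
    simp [Finset.filter_insert, Finset.filter_singleton, hvu, hvu', n3] at hov
    have b1 := h1 u (by simp)
    have b2 := h1 u' (by simp)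
    have b3 := (h1 v (by simp)).1
    simp only [ho, ho', card_empty] at b1 b2
    obtain ⟨c, hc, c', hc', h, hh, h', hh', hout, k1, k2, k3⟩ : ∃ c ≤ 1, ∃ c' ≤ 1, ∃ h ≤ 1,
        ∃ h' ≤ 1, (∀ y ∈ outer G {v, u, u'} (fun _ => ∅) v, β v + (c + c') + 1 ≠ β y) ∧
          β v + (c + c') + 1 ≠ 3 + c + h ∧ β v + (c + c') + 1 ≠ 3 + c' + h' ∧
          3 + c + h ≠ 3 + c' + h' := by
      by_cases hd2 : deg G v = 2
      · have ho : outer G {v, u, u'} (fun _ => ∅) v = ∅ := by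
          rw [← Finset.card_eq_zero]; omega
        exact ⟨1, by omega, 0, by omega, 0, by omega, 0, by omega, by simp [ho], by omega⟩
      · obtain ⟨n, hn, hn'⟩ := exists_shift_ne (outer G {v, u, u'} (fun _ => ∅) v) β (β v + 1) 2
          (by omega)
        have : n = 0 ∨ n = 1 ∨ n = 2 := by omega
        rcases this with rfl | rfl | rfl
        · exact ⟨0, by omega, 0, by omega, 0, by omega, 1, by omega, hn', by omega⟩
        · exact ⟨1, by omega, 0, by omega, 0, by omega, 0, by omega, hn', by omega⟩
        · exact ⟨1, by omega, 1, by omega, 0, by omega, 1, by omega,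
            fun y hy => by have := hn' y hy; omega, by omega⟩
    obtain ⟨m, hm, m', hm', hmm, hp⟩ := H
      (fun e => if e = s(v, u) then c else if e = s(v, u') then c' else 0)
      (fun x => if x = v then β v + (c + c') + 1 else if x = u then 3 + c + h else 3 + c' + h')
      (by intro e; split_ifs <;> omega) (by
        intro m hm
        simp only [mem_insert, mem_singleton] at hm
        rcases hm with rfl | rfl | rfl
        · refine Avail.of_eq_empty rfl 1 le_rfl ?_ (by simpa using hout)
          simp [Finset.filter_insert, Finset.filter_singleton, hvu, hvu', n3, n1, n2,
            n3.symm]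
        · refine Avail.of_eq_empty rfl h hh ?_ (by simp [ho])
          simp [Finset.filter_insert, Finset.filter_singleton, hvu.symm, huu', n3, n2, n1.symm]
          omega
        · refine Avail.of_eq_empty rfl h' hh' ?_ (by simp [ho'])
          simp [Finset.filter_insert, Finset.filter_singleton, hvu'.symm, huu'.symm, n1,
            n2.symm, n3.symm]
          omega)
    simp only [mem_insert, mem_singleton] at hm hm'
    rcases hm with rfl | rfl | rfl <;> rcases hm' with rfl | rfl | rfl <;>
      simp [n3.symm, n1.symm, n2.symm] at hmm hp <;> omega

/-- With `m` neighbours of degree at most `2`, a vertex of degree `d` has `m + 2` consecutive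
values and `d - m` other neighbours, so `d ≤ 2 * m + 1` leaves an admissible value. As the
smallest value is at least `d + 1`, the neighbours of small degree can be handled afterwards; for
`d = 4` the smallest value is not large enough, but then it is not needed either. -/
theorem two_mul_numNeighborsLE_lt (hG : IsMinimalTwoBad G) {v : V} (hv : 4 ≤ deg G v) :
    2 * numNeighborsLE G 2 v + 1 < deg G v := by
  by_contra hcon
  set L : Finset V := (G.neighborFinset v).filter fun u => deg G u ≤ 2 with hLdef
  have hcard : L.card = numNeighborsLE G 2 v := rfl
  have hLadj : ∀ l ∈ L, G.Adj v l := fun l hl => by simpa using (mem_filter.1 hl).1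
  have hLdeg : ∀ l ∈ L, deg G l ≤ 2 := fun l hl => (mem_filter.1 hl).2
  obtain ⟨β, h1, h2, h3, h4⟩ := exists_base_single hG (v := v) (L := L)
    (Finset.card_pos.1 (by omega)) hLadj
    (fun l hl l' hl' => not_adj_of_deg_le_two hG (hLdeg l hl) (hLdeg l' hl') (hLadj l hl) (hLadj l'
      hl'))
  by_cases hd : deg G v = 4
  · obtain ⟨n, hn, hn'⟩ := exists_shift_ne (outer G {v} (fun _ => L) v) β (β v + 1) L.card
      (by omega)
    refine h4 _ (Avail.of_large (n + 1) hLadj hLdeg (fun l hl => (h3 l hl).2) (by omega) (by omega)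
      (by omega) fun y hy => ?_)
    have := hn' y hy
    omega
  · obtain ⟨n, hn, hn'⟩ := exists_shift_ne (outer G {v} (fun _ => L) v) β (β v) (L.card + 1)
      (by omega)
    exact h4 _ (Avail.of_large n hLadj hLdeg (fun l hl => (h3 l hl).2) (by omega) (by omega)
      (by omega) hn')

theorem isTwoReducible_configC : IsTwoReducible.{u} configC := by
  rintro V _ G hG ⟨v, hv, h⟩
  have h1 := two_mul_numNeighborsLE_lt hG (v := v) (by omega)
  have h2 : (2 * (numNeighborsLE G 2 v : ℚ) + 1) < deg G v := by exact_mod_cast h1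
  linarith

/-- Degree `4` is covered by `two_mul_numNeighborsLE_lt`. In degrees `2` and `3` the colours are
small, and five choices of raises are enough to find an admissible one. -/
theorem isTwoReducible_configB : IsTwoReducible.{u} configB := by
  rintro V _ G hG ⟨v, u, u', hv, hne, hvu, hvu', hu, hu'⟩
  have hnadj := not_adj_of_deg_le_two hG hu hu' hvu hvu'
  by_cases hd : deg G v = 4
  · have h1 := two_mul_numNeighborsLE_lt hG (v := v) hd.ge
    have h2 : 1 < numNeighborsLE G 2 v := by
      refine Finset.one_lt_card.2 ⟨u, ?_, u', ?_, hne⟩ <;> simp [*]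
    omega
  have hLadj : ∀ l ∈ ({u, u'} : Finset V), G.Adj v l := by simp [hvu, hvu']
  obtain ⟨β, h1, h2, h3, h4⟩ := exists_base_single hG (v := v) (L := {u, u'}) (by simp) hLadj
    (by simp [hnadj, G.adj_comm u' u])
  have hcard : ({u, u'} : Finset V).card = 2 := Finset.card_pair hne
  rw [hcard] at h1 h2
  obtain ⟨Y, hY⟩ := exists_color_of_card_le_one
    (s := outer G {v} (fun _ => {u, u'}) v) (by omega) β
  obtain ⟨q, hq⟩ := exists_color_of_deg_le_two hu hvu β
  obtain ⟨q', hq'⟩ := exists_color_of_deg_le_two hu' hvu' β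
  have b1 := h3 u (by simp)
  have b2 := h3 u' (by simp)
  have key : ∀ h b b' : ℕ, h ≤ 1 → b ≤ 1 → b' ≤ 1 → ¬ (
      (∀ y ∈ outer G {v} (fun _ => {u, u'}) v, β v + h + (b + b') ≠ β y) ∧
      ¬ (β v + h + (b + b') = β u + b ∧ q = β u + b + 1) ∧
      ¬ (β v + h + (b + b') = β u + b + 1 ∧ q = β u + b) ∧
      ¬ (β v + h + (b + b') = β u' + b' ∧ q' = β u' + b' + 1) ∧
      ¬ (β v + h + (b + b') = β u' + b' + 1 ∧ q' = β u' + b')) := by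
    rintro h b b' hh hb hb' ⟨k0, k1, k2, k3, k4⟩
    obtain ⟨e, he, he1, he2⟩ := exists_raise_ne k1 k2
    obtain ⟨e', he', he1', he2'⟩ := exists_raise_ne k3 k4
    refine h4 (β v + h + (b + b')) ⟨h, hh, fun x => if x = u then b else b', ?_, ?_, k0, ?_⟩
    · intro x; dsimp only; split_ifs <;> omega
    · simp [Finset.sum_pair hne, hne.symm]
    · intro l hl
      simp only [mem_insert, mem_singleton] at hl
      rcases hl with rfl | rfl
      · exact ⟨e, he, by simpa using he1, fun x hx hxm => by rw [hq x hx hxm]; simpa using he2⟩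
      · exact ⟨e', he', by simpa [hne.symm] using he1',
          fun x hx hxm => by rw [hq' x hx hxm]; simpa [hne.symm] using he2'⟩
  have hd2 : deg G v = 2 ∨ deg G v = 3 := by
    have := two_le_deg hvu hvu' hne.symm
    omega
  have hY' : ∀ p, p ≠ Y ∨ deg G v = 2 → ∀ y ∈ outer G {v} (fun _ => {u, u'}) v, p ≠ β y := by
    intro p hp y hy
    rcases hp with hp | hp
    · rwa [hY y hy]
    · have := Finset.card_pos.2 ⟨y, hy⟩
      omega
  have key' : ∀ h b b' : ℕ, h ≤ 1 → b ≤ 1 → b' ≤ 1 → ¬ (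
      (β v + h + (b + b') ≠ Y ∨ deg G v = 2) ∧
      ¬ (β v + h + (b + b') = β u + b ∧ q = β u + b + 1) ∧
      ¬ (β v + h + (b + b') = β u + b + 1 ∧ q = β u + b) ∧
      ¬ (β v + h + (b + b') = β u' + b' ∧ q' = β u' + b' + 1) ∧
      ¬ (β v + h + (b + b') = β u' + b' + 1 ∧ q' = β u' + b')) := by
    rintro h b b' hh hb hb' ⟨k0, k⟩
    exact key h b b' hh hb hb' ⟨hY' _ k0, k⟩
  have a1 := key' 1 1 1 le_rfl le_rfl le_rfl
  have a2 := key' 1 1 0 le_rfl le_rfl (by omega)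
  have a3 := key' 1 0 1 le_rfl (by omega) le_rfl
  have a4 := key' 1 0 0 le_rfl (by omega) (by omega)
  have a5 := key' 0 0 0 (by omega) (by omega) (by omega)
  clear key key' hY' hY hq hq' h3 h4
  omega

/-! ### Two `3`-vertices close to each other whose `2`-neighbours interact -/

section TwoNeighbors

variable {v z z' u u' : V}

/-- Raising the edge `zz'` makes the colours of `z` and `z'` exceed `4` plus the raise of the
respective edge to `u`, hence larger than the smallest colour of `u`; after that `z` and `z'` have
three values each and one outer neighbour. -/
theorem false_of_adj_of_common_two (hG : IsMinimalTwoBad G) (hz : deg G z = 3)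
    (hz' : deg G z' = 3) (hu : deg G u = 2) (hzz' : G.Adj z z') (hzu : G.Adj z u)
    (hzu' : G.Adj z' u) : False := by
  have n1 := hzz'.ne
  have n2 := hzu.ne
  have n3 := hzu'.ne
  obtain ⟨β, hβ, -, -, H⟩ := exists_base_core hG {z, z', u} (fun _ => ∅) (by simp) (by simp)
      (by simp) (Or.inr ⟨z, by simp, z', by simp, hzz'⟩)
  have ho := fun m => card_outer (G := G) (M := {z, z', u}) (L := fun _ => ∅) (m := m) (by simp)
    (by simp)
  have o_z := ho z
  have b_z := hβ z (by simp)
  have o_z' := ho z'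
  have b_z' := hβ z' (by simp)
  have o_u := ho u
  have b_u := hβ u (by simp)
  simp [Finset.filter_insert, Finset.filter_singleton, hzz', hzu, hzu', hzz'.symm, hzu.symm,
    hzu'.symm, n1, n2, n3, hz, hz', hu] at o_z o_z' o_u
  have c_u : β u = 3 := by
    rw [o_u, card_empty] at b_u
    omega
  obtain ⟨Y_z, hY_z⟩ := exists_color_of_card_le_one (s := outer G {z, z', u} (fun _ => ∅) z)
    (by omega) β
  obtain ⟨Y_z', hY_z'⟩ := exists_color_of_card_le_one (s := outer G {z, z', u} (fun _ => ∅) z')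
    (by omega) β
  obtain ⟨b, hb, h, hh, k1, -⟩ := exists_shift_ne_two (β z + 1) Y_z Y_z
  obtain ⟨b', hb', h', hh', k2, k3⟩ := exists_shift_ne_two (β z' + 1) Y_z' (β z + 1 + b + h)
  obtain ⟨m, hm, m', hm', hmm, hp⟩ := H
    (fun e => if e = s(z, u) then b else if e = s(z', u) then b' else 1)
    (fun x => if x = z then β z + 1 + b + h else if x = z' then β z' + 1 + b' + h' else 3 + (b +
      b'))
    (by intro e; split_ifs <;> omega) (by
      intro m hm
      simp only [mem_insert, mem_singleton] at hm
      rcases hm with rfl | rfl | rfl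
      · refine Avail.of_eq_empty rfl h (by omega) ?_ (fun y hy => by rw [hY_z y hy]; simpa [n1, n2,
        n3, n1.symm, n2.symm, n3.symm] using k1)
        simp [Finset.filter_insert, Finset.filter_singleton, hzz', hzu, n1, n2, n3]
        omega
      · refine Avail.of_eq_empty rfl h' (by omega) ?_ (fun y hy => by rw [hY_z' y hy]; simpa [n1,
        n2, n3, n1.symm, n2.symm, n3.symm] using k2)
        simp [Finset.filter_insert, Finset.filter_singleton, hzu', hzz'.symm, n2, n3, n1.symm]
        omega
      · refine Avail.of_eq_empty rfl 0 (by omega) ?_ (by simp [o_u])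
        simp [Finset.filter_insert, Finset.filter_singleton, hzu.symm, hzu'.symm, n1, n1.symm,
          n2.symm, n3.symm]
        omega)
  simp only [mem_insert, mem_singleton] at hm hm'
  rcases hm with rfl | rfl | rfl <;> rcases hm' with rfl | rfl | rfl <;>
    simp [n1.symm, n2.symm, n3.symm] at hmm hp <;> omega

/-- As in `false_of_adj_of_common_two`: once the edge `zz'` is raised, the colours of `z` and `z'`
are larger than those of `u` and `u'`, if the edge `uu'` keeps weight `1`. -/
theorem false_of_adj_of_adj_two (hG : IsMinimalTwoBad G) (hz : deg G z = 3)
    (hz' : deg G z' = 3) (hu : deg G u = 2) (hu' : deg G u' = 2) (hzz' : G.Adj z z')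
    (hzu : G.Adj z u) (hzu' : G.Adj z' u') (huu' : G.Adj u u') (a1 : ¬ G.Adj z u')
    (a2 : ¬ G.Adj z' u) : False := by
  have n1 := hzz'.ne
  have n2 := hzu.ne
  have n3 := hzu'.ne
  have n4 := huu'.ne
  have n5 : z ≠ u' := fun h => by rw [h, hu'] at hz; omega
  have n6 : z' ≠ u := fun h => by rw [h, hu] at hz'; omega
  have a3 : ¬ G.Adj u' z := fun h => a1 h.symm
  have a4 : ¬ G.Adj u z' := fun h => a2 h.symm
  obtain ⟨β, hβ, -, -, H⟩ := exists_base_core hG {z, z', u, u'} (fun _ => ∅) (by simp) (by simp)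
      (by simp) (Or.inr ⟨z, by simp, z', by simp, hzz'⟩)
  have ho := fun m => card_outer (G := G) (M := {z, z', u, u'}) (L := fun _ => ∅) (m := m)
    (by simp) (by simp)
  have o_z := ho z
  have b_z := hβ z (by simp)
  have o_z' := ho z'
  have b_z' := hβ z' (by simp)
  have o_u := ho u
  have b_u := hβ u (by simp)
  have o_u' := ho u'
  have b_u' := hβ u' (by simp)
  simp [Finset.filter_insert, Finset.filter_singleton, hzz', hzu, hzu', huu', hzz'.symm, hzu.symm,
    hzu'.symm, huu'.symm, a1, a2, a3, a4, n5, n6, hz, hz', hu, hu'] at o_z o_z' o_u o_u'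
  have c_u : β u = 3 := by
    rw [o_u, card_empty] at b_u
    omega
  have c_u' : β u' = 3 := by
    rw [o_u', card_empty] at b_u'
    omega
  obtain ⟨Y_z, hY_z⟩ := exists_color_of_card_le_one (s := outer G {z, z', u, u'} (fun _ => ∅) z)
    (by omega) β
  obtain ⟨Y_z', hY_z'⟩ := exists_color_of_card_le_one (s := outer G {z, z', u, u'} (fun _ => ∅) z')
    (by omega) β
  obtain ⟨b, hb, h, hh, k1, -⟩ := exists_shift_ne_two (β z + 1) Y_z Y_z
  obtain ⟨b', hb', h', hh', k2, k3⟩ := exists_shift_ne_two (β z' + 1) Y_z' (β z + 1 + b + h)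
  obtain ⟨e, he, k4⟩ : ∃ e ≤ 1, 3 + b + 0 ≠ 3 + b' + e := by
    by_cases hbb : b = b'
    · exact ⟨1, by omega, by omega⟩
    · exact ⟨0, by omega, by omega⟩
  obtain ⟨m, hm, m', hm', hmm, hp⟩ := H
    (fun e => if e = s(z, u) then b else if e = s(z', u') then b' else if e = s(z, z') then 1 else
      0)
    (fun x => if x = z then β z + 1 + b + h else if x = z' then β z' + 1 + b' + h' else
      if x = u then 3 + b + 0 else 3 + b' + e)
    (by intro e; split_ifs <;> omega) (by
      intro m hm
      simp only [mem_insert, mem_singleton] at hm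
      rcases hm with rfl | rfl | rfl | rfl
      · refine Avail.of_eq_empty rfl h (by omega) ?_ (fun y hy => by rw [hY_z y hy]; simpa [n1, n2,
        n3, n4, n5, n6, n1.symm, n2.symm, n3.symm, n4.symm, n5.symm, n6.symm] using k1)
        simp [Finset.filter_insert, Finset.filter_singleton, hzz', hzu, a1, n1, n2, n5, n6]
        omega
      · refine Avail.of_eq_empty rfl h' (by omega) ?_ (fun y hy => by rw [hY_z' y hy]; simpa [n1,
        n2, n3, n4, n5, n6, n1.symm, n2.symm, n3.symm, n4.symm, n5.symm, n6.symm] using k2)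
        simp [Finset.filter_insert, Finset.filter_singleton, hzu', hzz'.symm, a2, n3, n5, n6,
          n1.symm]
        omega
      · refine Avail.of_eq_empty rfl 0 (by omega) ?_ (by simp [o_u])
        simp [Finset.filter_insert, Finset.filter_singleton, huu', hzu.symm, a4, n4, n5, n2.symm,
          n6.symm]
        omega
      · refine Avail.of_eq_empty rfl e (by omega) ?_ (by simp [o_u'])
        simp [Finset.filter_insert, Finset.filter_singleton, hzu'.symm, huu'.symm, a3, n6, n3.symm,
          n4.symm, n5.symm]
        omega)
  simp only [mem_insert, mem_singleton] at hm hm'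
  rcases hm with rfl | rfl | rfl | rfl <;> rcases hm' with rfl | rfl | rfl | rfl <;>
    simp [a1, a2, a3, a4, n1.symm, n2.symm, n3.symm, n4.symm, n5.symm, n6.symm] at hmm hp <;> omega

/-- Raising the edges `vz` and `vz'` makes the colours of `z` and `z'` larger than the smallest
colour of `u`. Then `v` has two values for one outer neighbour, and `z` and `z'` have three values
each, to avoid `v` and one outer neighbour. -/
theorem false_of_common_neighbor_of_common_two (hG : IsMinimalTwoBad G) (hv : deg G v = 3)
    (hz : deg G z = 3) (hz' : deg G z' = 3) (hu : deg G u = 2) (hvz : G.Adj v z)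
    (hvz' : G.Adj v z') (hzu : G.Adj z u) (hzu' : G.Adj z' u) (a1 : ¬ G.Adj z z')
    (n4 : z ≠ z') (a2 : ¬ G.Adj v u) : False := by
  have n1 := hvz.ne
  have n2 := hvz'.ne
  have n3 := hzu.ne
  have n5 := hzu'.ne
  have n6 : v ≠ u := fun h => by rw [h, hu] at hv; omega
  have a3 : ¬ G.Adj z' z := fun h => a1 h.symm
  have a4 : ¬ G.Adj u v := fun h => a2 h.symm
  obtain ⟨β, hβ, -, -, H⟩ := exists_base_core hG {v, z, z', u} (fun _ => ∅) (by simp) (by simp)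
      (by simp) (Or.inr ⟨v, by simp, z, by simp, hvz⟩)
  have ho := fun m => card_outer (G := G) (M := {v, z, z', u}) (L := fun _ => ∅) (m := m) (by simp)
    (by simp)
  have o_v := ho v
  have b_v := hβ v (by simp)
  have o_z := ho z
  have b_z := hβ z (by simp)
  have o_z' := ho z'
  have b_z' := hβ z' (by simp)
  have o_u := ho u
  have b_u := hβ u (by simp)
  simp [Finset.filter_insert, Finset.filter_singleton, hvz, hvz', hzu, hzu', hvz.symm, hvz'.symm,
    hzu.symm, hzu'.symm, a1, a2, a3, a4, n4, n6, hv, hz, hz', hu] at o_v o_z o_z' o_u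
  have c_u : β u = 3 := by
    rw [o_u, card_empty] at b_u
    omega
  obtain ⟨Y_v, hY_v⟩ := exists_color_of_card_le_one (s := outer G {v, z, z', u} (fun _ => ∅) v)
    (by omega) β
  obtain ⟨Y_z, hY_z⟩ := exists_color_of_card_le_one (s := outer G {v, z, z', u} (fun _ => ∅) z)
    (by omega) β
  obtain ⟨Y_z', hY_z'⟩ := exists_color_of_card_le_one (s := outer G {v, z, z', u} (fun _ => ∅) z')
    (by omega) β
  obtain ⟨g, hg, k0⟩ : ∃ g ≤ 1, β v + 2 + g ≠ Y_v := by
    by_cases hv : β v + 2 = Y_v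
    · exact ⟨1, by omega, by omega⟩
    · exact ⟨0, by omega, by omega⟩
  obtain ⟨b, hb, h, hh, k1, k2⟩ := exists_shift_ne_two (β z + 1) Y_z (β v + 2 + g)
  obtain ⟨b', hb', h', hh', k3, k4⟩ := exists_shift_ne_two (β z' + 1) Y_z' (β v + 2 + g)
  obtain ⟨m, hm, m', hm', hmm, hp⟩ := H
    (fun e => if e = s(z, u) then b else if e = s(z', u) then b' else 1)
    (fun x => if x = v then β v + 2 + g else if x = z then β z + 1 + b + h else
      if x = z' then β z' + 1 + b' + h' else 3 + (b + b'))
    (by intro e; split_ifs <;> omega) (by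
      intro m hm
      simp only [mem_insert, mem_singleton] at hm
      rcases hm with rfl | rfl | rfl | rfl
      · refine Avail.of_eq_empty rfl g (by omega) ?_ (fun y hy => by rw [hY_v y hy]; simpa [n1, n2,
        n3, n4, n5, n6, n1.symm, n2.symm, n3.symm, n4.symm, n5.symm, n6.symm] using k0)
        simp [Finset.filter_insert, Finset.filter_singleton, hvz, hvz', a2, n1, n2, n4, n6]
      · refine Avail.of_eq_empty rfl h (by omega) ?_ (fun y hy => by rw [hY_z y hy]; simpa [n1, n2,
        n3, n4, n5, n6, n1.symm, n2.symm, n3.symm, n4.symm, n5.symm, n6.symm] using k1)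
        simp [Finset.filter_insert, Finset.filter_singleton, hzu, hvz.symm, a1, n3, n4, n6, n1.symm]
        omega
      · refine Avail.of_eq_empty rfl h' (by omega) ?_ (fun y hy => by rw [hY_z' y hy]; simpa [n1,
        n2, n3, n4, n5, n6, n1.symm, n2.symm, n3.symm, n4.symm, n5.symm, n6.symm] using k3)
        simp [Finset.filter_insert, Finset.filter_singleton, hzu', hvz'.symm, a3, n5, n6, n2.symm,
          n4.symm]
        omega
      · refine Avail.of_eq_empty rfl 0 (by omega) ?_ (by simp [o_u])
        simp [Finset.filter_insert, Finset.filter_singleton, hzu.symm, hzu'.symm, a4, n4, n3.symm,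
          n4.symm, n5.symm, n6.symm]
        omega)
  simp only [mem_insert, mem_singleton] at hm hm'
  rcases hm with rfl | rfl | rfl | rfl <;> rcases hm' with rfl | rfl | rfl | rfl <;>
    simp [a1, a2, a3, a4, n1.symm, n2.symm, n3.symm, n4.symm, n5.symm, n6.symm] at hmm hp <;> omega

/-- As in `false_of_common_neighbor_of_common_two`, with two adjacent `2`-vertices in place of the
common one. -/
theorem false_of_common_neighbor_of_adj_two (hG : IsMinimalTwoBad G) (hv : deg G v = 3)
    (hz : deg G z = 3) (hz' : deg G z' = 3) (hu : deg G u = 2) (hu' : deg G u' = 2)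
    (hvz : G.Adj v z) (hvz' : G.Adj v z') (hzu : G.Adj z u) (hzu' : G.Adj z' u')
    (huu' : G.Adj u u') (a1 : ¬ G.Adj z z') (n4 : z ≠ z') (a2 : ¬ G.Adj v u)
    (a3 : ¬ G.Adj v u') (a4 : ¬ G.Adj z u') (a5 : ¬ G.Adj z' u) : False := by
  have n1 := hvz.ne
  have n2 := hvz'.ne
  have n3 := hzu.ne
  have n5 := hzu'.ne
  have n6 : v ≠ u := fun h => by rw [h, hu] at hv; omega
  have n7 : v ≠ u' := fun h => by rw [h, hu'] at hv; omega
  have n8 : z ≠ u' := fun h => by rw [h, hu'] at hz; omega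
  have n9 : z' ≠ u := fun h => by rw [h, hu] at hz'; omega
  have n10 := huu'.ne
  have a6 : ¬ G.Adj z' z := fun h => a1 h.symm
  have a7 : ¬ G.Adj u v := fun h => a2 h.symm
  have a8 : ¬ G.Adj u' v := fun h => a3 h.symm
  have a9 : ¬ G.Adj u' z := fun h => a4 h.symm
  have a10 : ¬ G.Adj u z' := fun h => a5 h.symm
  obtain ⟨β, hβ, -, -, H⟩ := exists_base_core hG {v, z, z', u, u'} (fun _ => ∅) (by simp) (by simp)
      (by simp) (Or.inr ⟨v, by simp, z, by simp, hvz⟩)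
  have ho := fun m => card_outer (G := G) (M := {v, z, z', u, u'}) (L := fun _ => ∅) (m := m)
    (by simp) (by simp)
  have o_v := ho v
  have b_v := hβ v (by simp)
  have o_z := ho z
  have b_z := hβ z (by simp)
  have o_z' := ho z'
  have b_z' := hβ z' (by simp)
  have o_u := ho u
  have b_u := hβ u (by simp)
  have o_u' := ho u'
  have b_u' := hβ u' (by simp)
  simp [Finset.filter_insert, Finset.filter_singleton, hvz, hvz', hzu, hzu', huu', hvz.symm,
    hvz'.symm, hzu.symm, hzu'.symm, huu'.symm, a1, a2, a3, a4, a5, a6, a7, a8, a9, a10, n4, n6, n7,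
      n8, n9, hv, hz, hz', hu, hu'] at o_v o_z o_z' o_u o_u'
  have c_u : β u = 3 := by
    rw [o_u, card_empty] at b_u
    omega
  have c_u' : β u' = 3 := by
    rw [o_u', card_empty] at b_u'
    omega
  obtain ⟨Y_v, hY_v⟩ := exists_color_of_card_le_one (s := outer G {v, z, z', u, u'} (fun _ => ∅) v)
    (by omega) β
  obtain ⟨Y_z, hY_z⟩ := exists_color_of_card_le_one (s := outer G {v, z, z', u, u'} (fun _ => ∅) z)
    (by omega) β
  obtain ⟨Y_z', hY_z'⟩ := exists_color_of_card_le_one (s := outer G {v, z, z', u, u'} (fun _ => ∅)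
    z') (by omega) β
  obtain ⟨g, hg, k0⟩ : ∃ g ≤ 1, β v + 2 + g ≠ Y_v := by
    by_cases hv : β v + 2 = Y_v
    · exact ⟨1, by omega, by omega⟩
    · exact ⟨0, by omega, by omega⟩
  obtain ⟨b, hb, h, hh, k1, k2⟩ := exists_shift_ne_two (β z + 1) Y_z (β v + 2 + g)
  obtain ⟨b', hb', h', hh', k3, k4⟩ := exists_shift_ne_two (β z' + 1) Y_z' (β v + 2 + g)
  obtain ⟨e, he, k5⟩ : ∃ e ≤ 1, 3 + b + 0 ≠ 3 + b' + e := by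
    by_cases hbb : b = b'
    · exact ⟨1, by omega, by omega⟩
    · exact ⟨0, by omega, by omega⟩
  obtain ⟨m, hm, m', hm', hmm, hp⟩ := H
    (fun e => if e = s(z, u) then b else if e = s(z', u') then b' else
      if e = s(u, u') then 0 else 1)
    (fun x => if x = v then β v + 2 + g else if x = z then β z + 1 + b + h else
      if x = z' then β z' + 1 + b' + h' else if x = u then 3 + b + 0 else 3 + b' + e)
    (by intro e; split_ifs <;> omega) (by
      intro m hm
      simp only [mem_insert, mem_singleton] at hm
      rcases hm with rfl | rfl | rfl | rfl | rfl
      · refine Avail.of_eq_empty rfl g (by omega) ?_ (fun y hy => by rw [hY_v y hy]; simpa [n1, n2,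
        n3, n4, n5, n6, n7, n8, n9, n10, n1.symm, n2.symm, n3.symm, n4.symm, n5.symm, n6.symm,
          n7.symm, n8.symm, n9.symm, n10.symm] using k0)
        simp [Finset.filter_insert, Finset.filter_singleton, hvz, hvz', a2, a3, n1, n2, n4, n6, n7]
      · refine Avail.of_eq_empty rfl h (by omega) ?_ (fun y hy => by rw [hY_z y hy]; simpa [n1, n2,
        n3, n4, n5, n6, n7, n8, n9, n10, n1.symm, n2.symm, n3.symm, n4.symm, n5.symm, n6.symm,
          n7.symm, n8.symm, n9.symm, n10.symm] using k1)
        simp [Finset.filter_insert, Finset.filter_singleton, hzu, hvz.symm, a1, a4, n3, n4, n6, n8,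
          n1.symm]
        omega
      · refine Avail.of_eq_empty rfl h' (by omega) ?_ (fun y hy => by rw [hY_z' y hy]; simpa [n1,
        n2, n3, n4, n5, n6, n7, n8, n9, n10, n1.symm, n2.symm, n3.symm, n4.symm, n5.symm, n6.symm,
          n7.symm, n8.symm, n9.symm, n10.symm] using k3)
        simp [Finset.filter_insert, Finset.filter_singleton, hzu', hvz'.symm, a5, a6, n5, n7, n9,
          n2.symm, n4.symm]
        omega
      · refine Avail.of_eq_empty rfl 0 (by omega) ?_ (by simp [o_u])
        simp [Finset.filter_insert, Finset.filter_singleton, huu', hzu.symm, a7, a10, n8, n10,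
          n3.symm, n6.symm, n8.symm, n9.symm]
        omega
      · refine Avail.of_eq_empty rfl e (by omega) ?_ (by simp [o_u'])
        simp [Finset.filter_insert, Finset.filter_singleton, hzu'.symm, huu'.symm, a8, a9, n9,
          n5.symm, n7.symm, n8.symm, n9.symm, n10.symm]
        omega)
  simp only [mem_insert, mem_singleton] at hm hm'
  rcases hm with rfl | rfl | rfl | rfl | rfl <;> rcases hm' with rfl | rfl | rfl | rfl | rfl <;>
    simp [a1, a2, a3, a4, a5, a6, a7, a8, a9, a10, n1.symm, n2.symm, n3.symm, n4.symm, n5.symm,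
      n6.symm, n7.symm, n8.symm, n9.symm, n10.symm] at hmm hp <;> omega

end TwoNeighbors

/-! ### Adjacent `β`- and `β'`-vertices -/

/-- The case of a core consisting of two adjacent vertices. -/
theorem exists_base_pair (hG : IsMinimalTwoBad G) {v z : V} (L : V → Finset V) (hvz : G.Adj v z)
    (hv : ∀ l ∈ L v, G.Adj v l ∧ l ≠ z ∧
      ∀ x, G.Adj l x → x ≠ v → x ≠ z ∧ x ∉ L v ∧ x ∉ L z)
    (hz : ∀ l ∈ L z, G.Adj z l ∧ l ≠ v ∧
      ∀ x, G.Adj l x → x ≠ z → x ≠ v ∧ x ∉ L v ∧ x ∉ L z) :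
    ∃ β : V → ℕ, ((outer G {v, z} L v).card + (L v).card + 1 = deg G v ∧
        deg G v + 1 ≤ β v ∧ β v ≤ deg G v + 1 + (outer G {v, z} L v).card) ∧
      ((outer G {v, z} L z).card + (L z).card + 1 = deg G z ∧
        deg G z + 1 ≤ β z ∧ β z ≤ deg G z + 1 + (outer G {v, z} L z).card) ∧
      (∀ l ∈ L v, deg G l + 1 ≤ β l ∧ β l ≤ 2 * deg G l) ∧
      (∀ l ∈ L z, deg G l + 1 ≤ β l ∧ β l ≤ 2 * deg G l) ∧
      ∀ c ≤ 1, ∀ p q, Avail G {v, z} L β v c p → Avail G {v, z} L β z c q → p = q := by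
  have n := hvz.ne
  have e1 : ∀ l ∈ L v, l ∉ ({v, z} : Finset V) := fun l hl => by
    simp [(hv l hl).1.ne', (hv l hl).2.1]
  have e2 : ∀ l ∈ L z, l ∉ ({v, z} : Finset V) := fun l hl => by
    simp [(hz l hl).1.ne', (hz l hl).2.1]
  have mem : ∀ {P : V → Prop}, P v → P z → ∀ m ∈ ({v, z} : Finset V), P m := by
    intro P h1 h2 m hm
    simp only [mem_insert, mem_singleton] at hm
    rcases hm with rfl | rfl
    · exact h1
    · exact h2
  obtain ⟨β, h1, h2, -, H⟩ := exists_base_core hG {v, z} L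
    (mem (fun l hl => (hv l hl).1) fun l hl => (hz l hl).1) (mem e1 e2)
    (mem (fun l hl x hx hxv => ⟨by simp [hxv, ((hv l hl).2.2 x hx hxv).1],
        mem ((hv l hl).2.2 x hx hxv).2.1 ((hv l hl).2.2 x hx hxv).2.2⟩)
      (fun l hl x hx hxv => ⟨by simp [hxv, ((hz l hl).2.2 x hx hxv).1],
        mem ((hz l hl).2.2 x hx hxv).2.1 ((hz l hl).2.2 x hx hxv).2.2⟩))
    (Or.inr ⟨v, by simp, z, by simp, hvz⟩)
  have o1 := card_outer (G := G) (M := {v, z}) (m := v) (fun l hl => (hv l hl).1) e1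
  have o2 := card_outer (G := G) (M := {v, z}) (m := z) (fun l hl => (hz l hl).1) e2
  simp [Finset.filter_insert, Finset.filter_singleton, hvz, hvz.symm] at o1 o2
  refine ⟨β, ⟨by omega, h1 v (by simp)⟩, ⟨by omega, h1 z (by simp)⟩, h2 v (by simp),
    h2 z (by simp), fun c hc p q hp hq => ?_⟩
  obtain ⟨m, hm, m', hm', hmm, hpq⟩ := H (fun _ => c) (fun x => if x = v then p else q)
    (fun _ => hc) (mem
      (by simpa [Finset.filter_insert, Finset.filter_singleton, hvz] using hp)
      (by simpa [Finset.filter_insert, Finset.filter_singleton, hvz.symm, n.symm] using hq))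
  simp only [mem_insert, mem_singleton] at hm hm'
  rcases hm with rfl | rfl <;> rcases hm' with rfl | rfl <;>
    simp [n.symm] at hmm hpq <;> omega

/-- Both `β`-vertices have an available colour if the edge between them is raised. If these are the
only ones, both have two available colours if that edge is not raised. -/
theorem IsBeta.not_adj (hG : IsMinimalTwoBad G) {v v' : V} (hv : IsBeta G v) (hv' : IsBeta G v') :
    ¬ G.Adj v v' := by
  intro h
  obtain ⟨u, hvu, hu⟩ := hv.exists_two
  obtain ⟨u', hvu', hu'⟩ := hv'.exists_two
  have n : v ≠ v' := h.ne
  have a1 : ¬ G.Adj v' u := fun h1 => false_of_adj_of_common_two hG hv.1 hv'.1 hu h hvu h1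
  have a2 : ¬ G.Adj v u' := fun h1 => false_of_adj_of_common_two hG hv.1 hv'.1 hu' h h1 hvu'
  have a3 : ¬ G.Adj u u' := fun h1 =>
    false_of_adj_of_adj_two hG hv.1 hv'.1 hu hu' h hvu hvu' h1 a2 a1
  have nu : u ≠ v' := fun h1 => by have := hv'.1; rw [← h1, hu] at this; omega
  have nu' : u' ≠ v := fun h1 => by have := hv.1; rw [← h1, hu'] at this; omega
  have hL : (fun x => if x = v then ({u} : Finset V) else {u'}) v = {u} := by simp
  have hL' : (fun x => if x = v then ({u} : Finset V) else {u'}) v' = {u'} := by simp [n.symm]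
  generalize (fun x => if x = v then ({u} : Finset V) else {u'}) = L at hL hL'
  obtain ⟨β, h1, h2, h3, h4, H⟩ := exists_base_pair hG L h
    (by
      intro l hl
      obtain rfl : l = u := by simpa [hL] using hl
      refine ⟨hvu, nu, fun x hx hxv => ⟨?_, ?_, ?_⟩⟩
      · rintro rfl; exact a1 hx.symm
      · rw [hL, mem_singleton]; exact hx.ne'
      · rw [hL', mem_singleton]; rintro rfl; exact a3 hx)
    (by
      intro l hl
      obtain rfl : l = u' := by simpa [hL'] using hl
      refine ⟨hvu', nu', fun x hx hxv => ⟨?_, ?_, ?_⟩⟩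
      · rintro rfl; exact a2 hx.symm
      · rw [hL, mem_singleton]; rintro rfl; exact a3 hx.symm
      · rw [hL', mem_singleton]; exact hx.ne')
  have h3 := h3 u (by simp [hL])
  have h4 := h4 u' (by simp [hL'])
  have d := hv.1
  have d' := hv'.1
  have c1 := h1.1
  have c2 := h2.1
  rw [hL, card_singleton] at c1
  rw [hL', card_singleton] at c2
  obtain ⟨⟨p, hp⟩, c, hc, q₁, q₂, hq, hq₁, hq₂⟩ :=
    exists_avail_of_beta (M := {v, v'}) (β := β) hL hvu hu (by omega) (by omega) (by omega)
  obtain ⟨⟨p', hp'⟩, c', hc', q₁', q₂', hq', hq₁', hq₂'⟩ :=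
    exists_avail_of_beta (M := {v, v'}) (β := β) hL' hvu' hu' (by omega) (by omega) (by omega)
  have k : c ≠ 1 := by
    rintro rfl
    exact hq ((H 1 le_rfl _ _ hq₁ hp').trans (H 1 le_rfl _ _ hq₂ hp').symm)
  have k' : c' ≠ 1 := by
    rintro rfl
    exact hq' ((H 1 le_rfl _ _ hp hq₁').symm.trans (H 1 le_rfl _ _ hp hq₂'))
  obtain rfl : c = 0 := by omega
  obtain rfl : c' = 0 := by omega
  exact hq ((H 0 hc _ _ hq₁ hq₁').trans (H 0 hc _ _ hq₂ hq₁').symm)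

/-- A `β'`-vertex of degree `2 * k` has `k + 1` values for `k` outer neighbours, whatever the weight
of the edge to the `β`-vertex, which has two available colours for one of the weights. -/
theorem IsBeta.not_adj_beta' (hG : IsMinimalTwoBad G) {v z : V} (hv : IsBeta G v)
    (hz : IsBeta' G z) : ¬ G.Adj v z := by
  intro h
  obtain ⟨u, hvu, hu⟩ := hv.exists_two
  have n : v ≠ z := h.ne
  have a1 : ¬ G.Adj z u := fun h1 => hz.ne_two h1 hu
  obtain ⟨k, hk, hd, hcard, -⟩ := hz
  have nu : u ≠ z := fun h1 => by rw [← h1, hu] at hd; omega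
  let S : Finset V := (G.neighborFinset z).filter fun x => deg G x = 1
  have hScard : S.card = k - 1 := hcard
  have hS : ∀ l ∈ S, G.Adj z l ∧ deg G l = 1 := fun l hl => by simpa [S] using hl
  have hL : (fun x => if x = v then ({u} : Finset V) else S) v = {u} := by simp
  have hL' : (fun x => if x = v then ({u} : Finset V) else S) z = S := by simp [n.symm]
  generalize (fun x => if x = v then ({u} : Finset V) else S) = L at hL hL'
  obtain ⟨β, h1, h2, h3, h4, H⟩ := exists_base_pair hG L h
    (by
      intro l hl
      obtain rfl : l = u := by simpa [hL] using hl
      refine ⟨hvu, nu, fun x hx hxv => ⟨?_, ?_, ?_⟩⟩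
      · rintro rfl; exact a1 hx.symm
      · rw [hL, mem_singleton]; exact hx.ne'
      · rw [hL']
        intro hxS
        exact nu (eq_of_adj_of_deg_eq_one (hS x hxS).2 (hS x hxS).1.symm hx.symm))
    (by
      intro l hl
      rw [hL'] at hl
      refine ⟨(hS l hl).1, ?_, fun x hx hxv => ?_⟩
      · rintro rfl
        have := hv.1
        have := (hS l hl).2
        omega
      · exact absurd (eq_of_adj_of_deg_eq_one (hS l hl).2 (hS l hl).1.symm hx) hxv)
  have h3 := h3 u (by simp [hL])
  have d := hv.1
  have c1 := h1.1
  have c2 := h2.1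
  rw [hL, card_singleton] at c1
  obtain ⟨-, c, hc, q₁, q₂, hq, hq₁, hq₂⟩ :=
    exists_avail_of_beta (M := {v, z}) (β := β) hL hvu hu (by omega) (by omega) (by omega)
  obtain ⟨p, -, hp⟩ := exists_avail_of_leaves (G := G) (M := {v, z}) (L := L) (m := z) β c
    (by
      intro l hl x hx
      rw [hL'] at hl
      exact eq_of_adj_of_deg_eq_one (hS l hl).2 (hS l hl).1.symm hx)
    (by rw [hL', hScard] at c2 ⊢; omega)
  exact hq ((H c hc _ _ hq₁ hp).trans (H c hc _ _ hq₂ hp).symm)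

theorem isTwoReducible_configD : IsTwoReducible.{u} configD :=
  fun _ _ _ hG ⟨_, _, h, hv, hv'⟩ => hv.not_adj hG hv' h

theorem isTwoReducible_configE : IsTwoReducible.{u} configE :=
  fun _ _ _ hG ⟨_, _, h, hv, hv'⟩ => hv.not_adj_beta' hG hv' h

/-- The core consists of the three `β'`-vertices, each with a leaf as its pendant. If the two
neighbours are adjacent, the core is a triangle, otherwise a star. -/
theorem isTwoReducible_configF : IsTwoReducible.{u} configF := by
  rintro V _ G hG ⟨v, z, z', hv, hv4, nz, ⟨hvz, hz, hz4⟩, hvz', hz', hz4'⟩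
  obtain ⟨l, hvl, hl⟩ := hv.exists_leaf hv4
  obtain ⟨x, hzx, hx⟩ := hz.exists_leaf hz4
  obtain ⟨y, hzy, hy⟩ := hz'.exists_leaf hz4'
  have n1 := hvz.ne
  have n2 := hvz'.ne
  have hL : (fun a => if a = v then ({l} : Finset V) else if a = z then {x} else {y}) v = {l} := by
    simp
  have hL1 : (fun a => if a = v then ({l} : Finset V) else if a = z then {x} else {y}) z = {x} := by
    simp [n1.symm]
  have hL2 : (fun a => if a = v then ({l} : Finset V) else if a = z then {x} else {y}) z' = {y} :=
    by
    simp [n2.symm, nz.symm]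
  generalize (fun a => if a = v then ({l} : Finset V) else if a = z then {x} else {y}) = L
    at hL hL1 hL2
  have mem : ∀ {P : V → Prop}, P v → P z → P z' → ∀ m ∈ ({v, z, z'} : Finset V), P m := by
    intro P h1 h2 h3 m hm
    simp only [mem_insert, mem_singleton] at hm
    rcases hm with rfl | rfl | rfl <;> assumption
  have hLl : ∀ m ∈ ({v, z, z'} : Finset V), ∃ a, L m = {a} ∧ G.Adj m a ∧ deg G a = 1 :=
    mem ⟨l, hL, hvl, hl⟩ ⟨x, hL1, hzx, hx⟩ ⟨y, hL2, hzy, hy⟩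
  have hd4 : ∀ m ∈ ({v, z, z'} : Finset V), deg G m = 4 := mem hv4 hz4 hz4'
  have hleaf : ∀ m ∈ ({v, z, z'} : Finset V), ∀ a ∈ L m, ∀ b, G.Adj a b → b = m := by
    intro m hm a ha b hab
    obtain ⟨a', h1, h2, h3⟩ := hLl m hm
    obtain rfl : a = a' := by simpa [h1] using ha
    exact eq_of_adj_of_deg_eq_one h3 h2.symm hab
  have hadj : ∀ m ∈ ({v, z, z'} : Finset V), ∀ a ∈ L m, G.Adj m a := by
    intro m hm a ha
    obtain ⟨a', h1, h2, h3⟩ := hLl m hm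
    obtain rfl : a = a' := by simpa [h1] using ha
    exact h2
  have hLM : ∀ m ∈ ({v, z, z'} : Finset V), ∀ a ∈ L m, a ∉ ({v, z, z'} : Finset V) := by
    intro m hm a ha haM
    obtain ⟨a', h1, h2, h3⟩ := hLl m hm
    obtain rfl : a = a' := by simpa [h1] using ha
    have := hd4 a haM
    omega
  obtain ⟨β, hβ, -, -, H⟩ := exists_base_core hG {v, z, z'} L hadj hLM
    (fun m hm a ha b hab hne => absurd (hleaf m hm a ha b hab) hne)
    (Or.inr ⟨v, by simp, z, by simp, hvz⟩)
  have ho : ∀ m ∈ ({v, z, z'} : Finset V), _ := fun m hm =>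
    card_outer (G := G) (hadj m hm) (hLM m hm)
  have o := ho v (by simp)
  have o1 := ho z (by simp)
  have o2 := ho z' (by simp)
  simp only [hL, hL1, hL2, hv4, hz4, hz4', Finset.card_singleton] at o o1 o2
  have hav : ∀ m ∈ ({v, z, z'} : Finset V), ∀ c, ∀ n ≤ 2,
      (∀ y ∈ outer G {v, z, z'} L m, β m + c + n ≠ β y) →
      Avail G {v, z, z'} L β m c (β m + c + n) := by
    intro m hm c n hn hout
    refine Avail.of_leaves n (hleaf m hm) ?_ hout
    obtain ⟨a, h1, -⟩ := hLl m hm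
    rw [h1, card_singleton]; omega
  have fin : ∀ c ≤ 1, ∀ c' ≤ 1, ∀ p q q', Avail G {v, z, z'} L β v (c + c') p →
      Avail G {v, z, z'} L β z c q → Avail G {v, z, z'} L β z' c' q' →
      p ≠ q → p ≠ q' → (G.Adj z z' → q ≠ q') → False := by
    intro c hc c' hc' p q q' hp hq hq' k1 k2 k3
    obtain ⟨m, hm, m', hm', hmm, hpq⟩ := H
      (fun e => if e = s(v, z) then c else if e = s(v, z') then c' else 0)
      (fun a => if a = v then p else if a = z then q else q') (by intro e; split_ifs <;> omega)
      (mem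
        (by simpa [Finset.sum_filter, hvz, hvz', n1, n1.symm, n2, n2.symm, nz, nz.symm] using hp)
        (by simpa [Finset.sum_filter, hvz.symm, n1, n1.symm, n2, n2.symm, nz, nz.symm] using hq)
        (by simpa [Finset.sum_filter, hvz'.symm, n1, n1.symm, n2, n2.symm, nz, nz.symm] using hq'))
    simp only [mem_insert, mem_singleton] at hm hm'
    rcases hm with rfl | rfl | rfl <;> rcases hm' with rfl | rfl | rfl <;>
      simp [n1.symm, n2.symm, nz.symm] at hmm hpq <;>
      first
        | omega
        | exact k3 hmm hpq
        | exact k3 hmm.symm hpq.symm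
  by_cases hzz : G.Adj z z'
  · simp [Finset.filter_insert, Finset.filter_singleton, hvz, hvz', hzz, nz, hvz.symm, hvz'.symm,
      hzz.symm, n1, n2] at o o1 o2
    obtain ⟨Y, hY⟩ := exists_color_of_card_le_one (s := outer G {v, z, z'} L v) (by omega) β
    obtain ⟨Y₂, hY₂⟩ := exists_color_of_card_le_one (s := outer G {v, z, z'} L z') (by omega) β
    obtain ⟨c, hc, h⟩ := exists_raise_pair (β v) Y (β z') Y₂
    obtain ⟨n, hn, hn'⟩ := exists_shift_ne (outer G {v, z, z'} L z) β (β z + c) 2 (by omega)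
    obtain ⟨t, ht, t', ht', k1, k2, k3, k4, k5⟩ := h (β z + c + n)
    exact fin c hc 0 (by omega) _ _ _
      (hav v (by simp) c t ht fun y hy => by rw [hY y hy]; exact k1)
      (hav z (by simp) c n hn hn')
      (hav z' (by simp) 0 t' ht' fun y hy => by rw [hY₂ y hy]; exact k2) k3 k5 (fun _ => k4.symm)
  · have hzz' : ¬ G.Adj z' z := fun h => hzz h.symm
    simp [Finset.filter_insert, Finset.filter_singleton, hvz, hvz', hzz, hzz', nz, hvz.symm,
      hvz'.symm] at o o1 o2
    obtain ⟨Y, hY⟩ := exists_color_of_card_le_one (s := outer G {v, z, z'} L v) (by omega) β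
    have e1 := fun c => exists_avail_of_leaves (G := G) (M := {v, z, z'}) β c
      (hleaf z (by simp)) (by rw [hL1, card_singleton]; omega)
    have e2 := fun c => exists_avail_of_leaves (G := G) (M := {v, z, z'}) β c
      (hleaf z' (by simp)) (by rw [hL2, card_singleton]; omega)
    choose α _ hα using e1
    choose α' _ hα' using e2
    obtain ⟨c, hc, c', hc', t, ht, k1, k2, k3⟩ := exists_raise_star (β v) Y α α'
    exact fin c hc c' hc' _ _ _
      (hav v (by simp) (c + c') t ht fun y hy => by rw [hY y hy]; exact k1)
      (hα c) (hα' c') k2 k3 (fun h => (hzz h).elim)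

/-! ### A `3`-vertex surrounded by `β`-vertices and `β'`-vertices -/

/-- The vertex `z` is a `β`-vertex with `2`-neighbour `l`, or a `β'`-vertex of degree `4` with
`1`-neighbour `l`. -/
def IsArm (G : SimpleGraph V) (z l : V) : Prop :=
  G.Adj z l ∧ (IsBeta G z ∧ deg G l = 2 ∨ (IsBeta' G z ∧ deg G z = 4) ∧ deg G l = 1)

theorem exists_isArm {z : V} (h : IsBeta G z ∨ IsBeta' G z ∧ deg G z = 4) :
    ∃ l, IsArm G z l := by
  rcases h with h | h
  · obtain ⟨l, h1, h2⟩ := h.exists_two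
    exact ⟨l, h1, Or.inl ⟨h, h2⟩⟩
  · obtain ⟨l, h1, h2⟩ := h.1.exists_leaf h.2
    exact ⟨l, h1, Or.inr ⟨h, h2⟩⟩

theorem IsArm.deg_ge {z l : V} (h : IsArm G z l) : 3 ≤ deg G z := by
  rcases h.2 with h | h
  · exact h.1.1.ge
  · have := h.1.2; omega

theorem IsArm.deg_le {z l : V} (h : IsArm G z l) : deg G l ≤ 2 := by
  rcases h.2 with h | h <;> omega

/-- The pendants of two arms at a common `3`-vertex do not interact. -/
theorem IsArm.not_adj {v z z' l l' : V} (hG : IsMinimalTwoBad G) (hv : deg G v = 3)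
    (hvz : G.Adj v z) (hvz' : G.Adj v z') (n : z ≠ z') (h : IsArm G z l) (h' : IsArm G z' l')
    (hvl : ¬ G.Adj v l) (hvl' : ¬ G.Adj v l') : ¬ G.Adj l z' ∧ ¬ G.Adj l l' := by
  have hd := h.deg_ge
  have hd' := h'.deg_ge
  have hzl := h.1
  have hzl' := h'.1
  rcases h.2 with ⟨hz, hl⟩ | ⟨hz, hl⟩
  · rcases h'.2 with ⟨hz', hl'⟩ | ⟨hz', hl'⟩
    · have a := hz.not_adj hG hz'
      have k1 : ¬ G.Adj z' l := fun hh =>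
        false_of_common_neighbor_of_common_two hG hv hz.1 hz'.1 hl hvz hvz' hzl hh a n hvl
      have k2 : ¬ G.Adj z l' := fun hh =>
        false_of_common_neighbor_of_common_two hG hv hz.1 hz'.1 hl' hvz hvz' hh hzl' a n hvl'
      exact ⟨fun hh => k1 hh.symm, fun hh => false_of_common_neighbor_of_adj_two hG hv hz.1 hz'.1
        hl hl' hvz hvz' hzl hzl' hh a n hvl hvl' k2 k1⟩
    · refine ⟨fun hh => hz'.1.ne_two hh.symm hl, fun hh => ?_⟩
      have := eq_of_adj_of_deg_eq_one hl' hzl'.symm hh.symm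
      subst this
      omega
  · refine ⟨fun hh => n (eq_of_adj_of_deg_eq_one hl hzl.symm hh).symm, fun hh => ?_⟩
    have := eq_of_adj_of_deg_eq_one hl hzl.symm hh
    subst this
    have := h'.deg_le
    omega

/-- An arm with one edge to the core has an available colour if this edge is raised. Moreover it
has two available colours for one weight of this edge (a `β`-vertex), or it has an available
colour `≥ 5` for every weight of it (a `β'`-vertex). -/
theorem IsArm.avail {M : Finset V} {L : V → Finset V} {β : V → ℕ} {z l : V} (h : IsArm G z l)
    (hL : L z = {l}) (hout : (outer G M L z).card + 2 = deg G z)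
    (hz : deg G z + 1 ≤ β z ∧ β z ≤ deg G z + 1 + (outer G M L z).card)
    (hl : deg G l + 1 ≤ β l ∧ β l ≤ 2 * deg G l) :
    (∃ p, Avail G M L β z 1 p) ∧
      ((∃ c ≤ 1, ∀ f, ∃ p, p ≠ f ∧ Avail G M L β z c p) ∨
        ∀ c, ∃ p, 5 ≤ p ∧ Avail G M L β z c p) := by
  rcases h.2 with ⟨hz', hl'⟩ | ⟨hz', hl'⟩
  · have := hz'.1
    obtain ⟨h1, c, hc, p, p', hne, hp, hp'⟩ :=
      exists_avail_of_beta (M := M) (β := β) hL h.1 hl' (by omega) (by omega) (by omega)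
    refine ⟨h1, Or.inl ⟨c, hc, fun f => ?_⟩⟩
    by_cases hf : p = f
    · exact ⟨p', fun h => hne (hf.trans h.symm), hp'⟩
    · exact ⟨p, hf, hp⟩
  · have := hz'.2
    have key : ∀ c, ∃ p, 5 ≤ p ∧ Avail G M L β z c p := by
      intro c
      obtain ⟨p, hp, hp'⟩ := exists_avail_of_leaves (G := G) (M := M) (L := L) (m := z) β c
        (by
          intro a ha x hx
          obtain rfl : a = l := by simpa [hL] using ha
          exact eq_of_adj_of_deg_eq_one hl' h.1.symm hx)
        (by rw [hL, card_singleton]; omega)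
      exact ⟨p, by omega, hp'⟩
    exact ⟨(key 1).imp fun _ h => h.2, Or.inr key⟩

section Star

variable {v z₁ z₂ z₃ l₁ l₂ l₃ : V}

/-- The case of a core consisting of a `3`-vertex `v` and its three neighbours, all of them arms.
The colour of `v` starts from `4`, and `v` has no outer neighbours. -/
theorem exists_base_star (hG : IsMinimalTwoBad G) (hv : deg G v = 3) (h₁ : G.Adj v z₁)
    (h₂ : G.Adj v z₂) (h₃ : G.Adj v z₃) (n₁₂ : z₁ ≠ z₂) (n₁₃ : z₁ ≠ z₃) (n₂₃ : z₂ ≠ z₃)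
    (k₁ : IsArm G z₁ l₁) (k₂ : IsArm G z₂ l₂) (k₃ : IsArm G z₃ l₃) :
    ∃ (M : Finset V) (L : V → Finset V) (β : V → ℕ), M = {v, z₁, z₂, z₃} ∧
      (∀ z ∈ M, z ≠ v → (outer G M L z).card + (M.filter (G.Adj z)).card + 1 = deg G z ∧
        deg G z + 1 ≤ β z ∧ β z ≤ deg G z + 1 + (outer G M L z).card) ∧
      (L z₁ = {l₁} ∧ deg G l₁ + 1 ≤ β l₁ ∧ β l₁ ≤ 2 * deg G l₁) ∧
      (L z₂ = {l₂} ∧ deg G l₂ + 1 ≤ β l₂ ∧ β l₂ ≤ 2 * deg G l₂) ∧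
      (L z₃ = {l₃} ∧ deg G l₃ + 1 ≤ β l₃ ∧ β l₃ ≤ 2 * deg G l₃) ∧
      ∀ c₁ ≤ 1, ∀ c₂ ≤ 1, ∀ c₃ ≤ 1, ∀ h ≤ 1, ∀ p₁ p₂ p₃,
        p₁ ≠ 4 + (c₁ + (c₂ + c₃)) + h → p₂ ≠ 4 + (c₁ + (c₂ + c₃)) + h →
        p₃ ≠ 4 + (c₁ + (c₂ + c₃)) + h → Avail G M L β z₁ c₁ p₁ → Avail G M L β z₂ c₂ p₂ →
        Avail G M L β z₃ c₃ p₃ → (G.Adj z₁ z₂ → p₁ ≠ p₂) → (G.Adj z₁ z₃ → p₁ ≠ p₃) →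
        (G.Adj z₂ z₃ → p₂ ≠ p₃) → False := by
  have m₁ := h₁.ne
  have m₂ := h₂.ne
  have m₃ := h₃.ne
  have hN : G.neighborFinset v = {z₁, z₂, z₃} := by
    symm
    refine Finset.eq_of_subset_of_card_le ?_ ?_
    · intro x hx
      simp only [mem_insert, mem_singleton] at hx
      rcases hx with rfl | rfl | rfl <;> simpa
    · rw [Finset.card_eq_three.2 ⟨_, _, _, n₁₂, n₁₃, n₂₃, rfl⟩,
        SimpleGraph.card_neighborFinset_eq_degree]
      exact hv.le
  have hvl : ∀ x, deg G x ≤ 2 → ¬ G.Adj v x := by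
    intro x hx hvx
    have : x ∈ G.neighborFinset v := by simpa
    rw [hN] at this
    simp only [mem_insert, mem_singleton] at this
    have := k₁.deg_ge
    have := k₂.deg_ge
    have := k₃.deg_ge
    rcases ‹x = z₁ ∨ x = z₂ ∨ x = z₃› with rfl | rfl | rfl <;> omega
  have a₁ := hvl l₁ k₁.deg_le
  have a₂ := hvl l₂ k₂.deg_le
  have a₃ := hvl l₃ k₃.deg_le
  let L : V → Finset V := fun a => if a = z₁ then {l₁} else if a = z₂ then {l₂} else
    if a = z₃ then {l₃} else ∅
  have hLv : L v = ∅ := by simp [L, m₁, m₂, m₃]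
  have hL₁ : L z₁ = {l₁} := by simp [L]
  have hL₂ : L z₂ = {l₂} := by simp [L, n₁₂.symm]
  have hL₃ : L z₃ = {l₃} := by simp [L, n₁₃.symm, n₂₃.symm]
  clear_value L
  have mem : ∀ {P : V → Prop}, P v → P z₁ → P z₂ → P z₃ →
      ∀ m ∈ ({v, z₁, z₂, z₃} : Finset V), P m := by
    intro P h1 h2 h3 h4 m hm
    simp only [mem_insert, mem_singleton] at hm
    rcases hm with rfl | rfl | rfl | rfl <;> assumption
  have hdeg : ∀ m ∈ ({v, z₁, z₂, z₃} : Finset V), 3 ≤ deg G m :=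
    mem hv.ge k₁.deg_ge k₂.deg_ge k₃.deg_ge
  have hadj : ∀ m ∈ ({v, z₁, z₂, z₃} : Finset V), ∀ l ∈ L m, G.Adj m l :=
    mem (by simp [hLv]) (by simpa [hL₁] using k₁.1) (by simpa [hL₂] using k₂.1)
      (by simpa [hL₃] using k₃.1)
  have hLM : ∀ m ∈ ({v, z₁, z₂, z₃} : Finset V), ∀ l ∈ L m,
      l ∉ ({v, z₁, z₂, z₃} : Finset V) := by
    have : ∀ m ∈ ({v, z₁, z₂, z₃} : Finset V), ∀ l ∈ L m, deg G l ≤ 2 :=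
      mem (by simp [hLv]) (by simpa [hL₁] using k₁.deg_le) (by simpa [hL₂] using k₂.deg_le)
        (by simpa [hL₃] using k₃.deg_le)
    intro m hm l hl hlM
    have h1 := this m hm l hl
    have h2 := hdeg l hlM
    omega
  have r₁₂ := k₁.not_adj hG hv h₁ h₂ n₁₂ k₂ a₁ a₂
  have r₁₃ := k₁.not_adj hG hv h₁ h₃ n₁₃ k₃ a₁ a₃
  have r₂₁ := k₂.not_adj hG hv h₂ h₁ n₁₂.symm k₁ a₂ a₁
  have r₂₃ := k₂.not_adj hG hv h₂ h₃ n₂₃ k₃ a₂ a₃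
  have r₃₁ := k₃.not_adj hG hv h₃ h₁ n₁₃.symm k₁ a₃ a₁
  have r₃₂ := k₃.not_adj hG hv h₃ h₂ n₂₃.symm k₂ a₃ a₂
  have key : ∀ m l x, G.Adj l x → x ≠ m → (x ≠ v ∧ (z₁ ≠ m → x ≠ z₁) ∧ (z₂ ≠ m → x ≠ z₂) ∧
      (z₃ ≠ m → x ≠ z₃)) → (x ≠ l₁ ∧ x ≠ l₂ ∧ x ≠ l₃) →
      x ∉ ({v, z₁, z₂, z₃} : Finset V) ∧ ∀ m' ∈ ({v, z₁, z₂, z₃} : Finset V), x ∉ L m' := by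
    rintro m l x hlx hxm ⟨e0, e1, e2, e3⟩ ⟨e4, e5, e6⟩
    constructor
    · simp only [mem_insert, mem_singleton, not_or]
      exact ⟨e0, fun h => e1 (h ▸ hxm) h, fun h => e2 (h ▸ hxm) h, fun h => e3 (h ▸ hxm) h⟩
    · exact mem (by simp [hLv]) (by simpa [hL₁] using e4) (by simpa [hL₂] using e5)
        (by simpa [hL₃] using e6)
  have ne_of : ∀ {l x y : V}, G.Adj l x → ¬ G.Adj l y → x ≠ y := fun h1 h2 h => h2 (h ▸ h1)
  obtain ⟨β, hβ, hβl, -, H⟩ := exists_base_core hG {v, z₁, z₂, z₃} L hadj hLM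
    (mem (by simp [hLv])
      (by
        intro l hl x hx hxz
        obtain rfl : l = l₁ := by simpa [hL₁] using hl
        exact key _ _ x hx hxz ⟨ne_of hx fun h => a₁ h.symm, fun h => (h rfl).elim,
          fun _ => ne_of hx r₁₂.1, fun _ => ne_of hx r₁₃.1⟩
          ⟨hx.ne', ne_of hx r₁₂.2, ne_of hx r₁₃.2⟩)
      (by
        intro l hl x hx hxz
        obtain rfl : l = l₂ := by simpa [hL₂] using hl
        exact key _ _ x hx hxz ⟨ne_of hx fun h => a₂ h.symm, fun _ => ne_of hx r₂₁.1,
          fun h => (h rfl).elim, fun _ => ne_of hx r₂₃.1⟩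
          ⟨ne_of hx r₂₁.2, hx.ne', ne_of hx r₂₃.2⟩)
      (by
        intro l hl x hx hxz
        obtain rfl : l = l₃ := by simpa [hL₃] using hl
        exact key _ _ x hx hxz ⟨ne_of hx fun h => a₃ h.symm, fun _ => ne_of hx r₃₁.1,
          fun _ => ne_of hx r₃₂.1, fun h => (h rfl).elim⟩
          ⟨ne_of hx r₃₁.2, ne_of hx r₃₂.2, hx.ne'⟩))
    (Or.inr ⟨v, by simp, z₁, by simp, h₁⟩)
  have ho : ∀ m ∈ ({v, z₁, z₂, z₃} : Finset V), _ := fun m hm =>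
    card_outer (G := G) (hadj m hm) (hLM m hm)
  have ov : outer G {v, z₁, z₂, z₃} L v = ∅ := by
    have o := ho v (by simp)
    simp [Finset.filter_insert, Finset.filter_singleton, h₁, h₂, h₃, n₁₂, n₁₃, n₂₃, hv] at o
    exact Finset.card_eq_zero.1 (by omega)
  have bv := hβ v (by simp)
  rw [ov, hv, card_empty] at bv
  have bv4 : β v = 4 := by omega
  refine ⟨{v, z₁, z₂, z₃}, L, β, rfl, ?_, ⟨hL₁, hβl z₁ (by simp) l₁ (by simp [hL₁])⟩,
    ⟨hL₂, hβl z₂ (by simp) l₂ (by simp [hL₂])⟩, ⟨hL₃, hβl z₃ (by simp) l₃ (by simp [hL₃])⟩, ?_⟩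
  · intro z hz hzv
    have h1 : (L z).card = 1 := by
      simp only [mem_insert, mem_singleton] at hz
      rcases hz with rfl | rfl | rfl | rfl
      · exact (hzv rfl).elim
      all_goals simp [*]
    have h2 := ho z hz
    rw [h1] at h2
    exact ⟨h2, hβ z hz⟩
  · intro c₁ hc₁ c₂ hc₂ c₃ hc₃ h hh p₁ p₂ p₃ e₁ e₂ e₃ q₁ q₂ q₃ d₁₂ d₁₃ d₂₃
    obtain ⟨m, hm, m', hm', hmm, hpq⟩ := H
      (fun e => if e = s(v, z₁) then c₁ else if e = s(v, z₂) then c₂ else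
        if e = s(v, z₃) then c₃ else 0)
      (fun a => if a = v then 4 + (c₁ + (c₂ + c₃)) + h else if a = z₁ then p₁ else
        if a = z₂ then p₂ else p₃) (by intro e; split_ifs <;> omega)
      (mem
        (Avail.of_eq_empty hLv h hh (by simp [Finset.sum_filter, h₁, h₂, h₃, m₁, m₂, m₃,
          n₁₂, n₁₂.symm, n₁₃, n₁₃.symm, n₂₃, n₂₃.symm, bv4]) (by simp [ov]))
        (by simpa [Finset.sum_filter, h₁.symm, m₁, m₂, m₃, m₁.symm, m₂.symm, m₃.symm, n₁₂,
          n₁₂.symm, n₁₃, n₁₃.symm, n₂₃, n₂₃.symm] using q₁)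
        (by simpa [Finset.sum_filter, h₂.symm, m₁, m₂, m₃, m₁.symm, m₂.symm, m₃.symm, n₁₂,
          n₁₂.symm, n₁₃, n₁₃.symm, n₂₃, n₂₃.symm] using q₂)
        (by simpa [Finset.sum_filter, h₃.symm, m₁, m₂, m₃, m₁.symm, m₂.symm, m₃.symm, n₁₂,
          n₁₂.symm, n₁₃, n₁₃.symm, n₂₃, n₂₃.symm] using q₃))
    simp only [mem_insert, mem_singleton] at hm hm'
    rcases hm with rfl | rfl | rfl | rfl <;> rcases hm' with rfl | rfl | rfl | rfl <;>
      simp [m₁.symm, m₂.symm, m₃.symm, n₁₂.symm, n₁₃.symm, n₂₃.symm] at hmm hpq <;>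
      first
        | omega
        | exact d₁₂ hmm hpq
        | exact d₁₂ hmm.symm hpq.symm
        | exact d₁₃ hmm hpq
        | exact d₁₃ hmm.symm hpq.symm
        | exact d₂₃ hmm hpq
        | exact d₂₃ hmm.symm hpq.symm

theorem IsArm.isBeta'_of_adj (hG : IsMinimalTwoBad G) {z z' l l' : V} (h : IsArm G z l)
    (h' : IsArm G z' l') (hzz' : G.Adj z z') : IsBeta' G z ∧ deg G z = 4 := by
  rcases h.2 with ⟨hz, -⟩ | ⟨hz, -⟩
  · rcases h'.2 with ⟨hz', -⟩ | ⟨hz', -⟩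
    · exact (hz.not_adj hG hz' hzz').elim
    · exact (hz.not_adj_beta' hG hz'.1 hzz').elim
  · exact hz

/-- If the arms `z₁` and `z₂` are adjacent, both are `β'`-vertices of degree `4` and `z₃` is not
adjacent to them. First `z₃` is coloured, then `v`, and last `z₁` and `z₂`, where the weight of
the edge `vz₁` has been chosen such that the last step works for every colour of `v`. -/
theorem false_of_star_of_adj (hG : IsMinimalTwoBad G) (hv : deg G v = 3) (h₁ : G.Adj v z₁)
    (h₂ : G.Adj v z₂) (h₃ : G.Adj v z₃) (n₁₂ : z₁ ≠ z₂) (n₁₃ : z₁ ≠ z₃) (n₂₃ : z₂ ≠ z₃)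
    (k₁ : IsArm G z₁ l₁) (k₂ : IsArm G z₂ l₂) (k₃ : IsArm G z₃ l₃) (h₁₂ : G.Adj z₁ z₂) :
    False := by
  have b₁ := k₁.isBeta'_of_adj hG k₂ h₁₂
  have b₂ := k₂.isBeta'_of_adj hG k₁ h₁₂.symm
  have a₁₃ : ¬ G.Adj z₁ z₃ := fun h => isTwoReducible_configF V G hG
    ⟨z₁, z₂, z₃, b₁.1, b₁.2, n₂₃, ⟨h₁₂, b₂⟩, h, k₃.isBeta'_of_adj hG k₁ h.symm⟩
  have a₂₃ : ¬ G.Adj z₂ z₃ := fun h => isTwoReducible_configF V G hG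
    ⟨z₂, z₁, z₃, b₂.1, b₂.2, n₁₃, ⟨h₁₂.symm, b₁⟩, h, k₃.isBeta'_of_adj hG k₂ h.symm⟩
  have a₃₁ : ¬ G.Adj z₃ z₁ := fun h => a₁₃ h.symm
  have a₃₂ : ¬ G.Adj z₃ z₂ := fun h => a₂₃ h.symm
  have leaf : ∀ {z l}, IsArm G z l → IsBeta' G z → ∀ x, G.Adj l x → x = z := by
    intro z l k b x hx
    rcases k.2 with ⟨-, hl⟩ | ⟨-, hl⟩
    · exact (b.ne_two k.1 hl).elim
    · exact eq_of_adj_of_deg_eq_one hl k.1.symm hx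
  obtain ⟨M, L, β, hM, hβ, hL₁, hL₂, hL₃, H⟩ :=
    exists_base_star hG hv h₁ h₂ h₃ n₁₂ n₁₃ n₂₃ k₁ k₂ k₃
  have c₁ := hβ z₁ (by simp [hM]) h₁.ne'
  have c₂ := hβ z₂ (by simp [hM]) h₂.ne'
  have c₃ := hβ z₃ (by simp [hM]) h₃.ne'
  have f₁ : (M.filter (G.Adj z₁)).card = 2 := by
    simp [hM, Finset.filter_insert, Finset.filter_singleton, h₁.symm, h₁₂, a₁₃, h₂.ne]
  have f₂ : (M.filter (G.Adj z₂)).card = 2 := by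
    simp [hM, Finset.filter_insert, Finset.filter_singleton, h₂.symm, h₁₂.symm, a₂₃, h₁.ne]
  have f₃ : (M.filter (G.Adj z₃)).card = 1 := by
    simp [hM, Finset.filter_insert, Finset.filter_singleton, h₃.symm, a₃₁, a₃₂]
  obtain ⟨Y₁, hY₁⟩ := exists_color_of_card_le_one (s := outer G M L z₁) (by omega) β
  obtain ⟨Y₂, hY₂⟩ := exists_color_of_card_le_one (s := outer G M L z₂) (by omega) β
  obtain ⟨c, hc, hpair⟩ := exists_raise_pair (β z₁) Y₁ (β z₂) Y₂
  obtain ⟨⟨p₃, hp₃⟩, -⟩ := k₃.avail hL₃.1 (by omega) c₃.2 hL₃.2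
  obtain ⟨h, hh, hp₃'⟩ : ∃ h ≤ 1, p₃ ≠ 4 + (c + (0 + 1)) + h := by
    by_cases hp : p₃ = 4 + (c + (0 + 1))
    · exact ⟨1, by omega, by omega⟩
    · exact ⟨0, by omega, by omega⟩
  obtain ⟨t₁, ht₁, t₂, ht₂, e₁, e₂, e₃, e₄, e₅⟩ := hpair (4 + (c + (0 + 1)) + h)
  refine H c hc 0 (by omega) 1 (by omega) h hh (β z₁ + c + t₁) (β z₂ + 0 + t₂) p₃ e₃ e₄ hp₃'
    (Avail.of_leaves t₁ ?_ (by rw [hL₁.1, card_singleton]; omega)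
      (fun y hy => by rw [hY₁ y hy]; exact e₁))
    (Avail.of_leaves t₂ ?_ (by rw [hL₂.1, card_singleton]; omega)
      (fun y hy => by rw [hY₂ y hy]; exact e₂)) hp₃ (fun _ => e₅)
    (fun h => (a₁₃ h).elim) (fun h => (a₂₃ h).elim)
  · simpa [hL₁.1] using leaf k₁ b₁.1
  · simpa [hL₂.1] using leaf k₂ b₂.1

end Star

theorem isTwoReducible_configG : IsTwoReducible.{u} configG := by
  rintro V _ G hG ⟨v, hv, hz⟩
  obtain ⟨z₁, z₂, z₃, n₁₂, n₁₃, n₂₃, hN⟩ := Finset.card_eq_three.1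
    ((SimpleGraph.card_neighborFinset_eq_degree G v).trans hv)
  have hadj : ∀ z ∈ ({z₁, z₂, z₃} : Finset V), G.Adj v z := fun z hz => by
    rw [← hN] at hz; simpa using hz
  have h₁ := hadj z₁ (by simp)
  have h₂ := hadj z₂ (by simp)
  have h₃ := hadj z₃ (by simp)
  obtain ⟨l₁, k₁⟩ := exists_isArm (hz z₁ h₁)
  obtain ⟨l₂, k₂⟩ := exists_isArm (hz z₂ h₂)
  obtain ⟨l₃, k₃⟩ := exists_isArm (hz z₃ h₃)
  have a₁₂ : ¬ G.Adj z₁ z₂ := false_of_star_of_adj hG hv h₁ h₂ h₃ n₁₂ n₁₃ n₂₃ k₁ k₂ k₃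
  have a₁₃ : ¬ G.Adj z₁ z₃ :=
    false_of_star_of_adj hG hv h₁ h₃ h₂ n₁₃ n₁₂ n₂₃.symm k₁ k₃ k₂
  have a₂₃ : ¬ G.Adj z₂ z₃ :=
    false_of_star_of_adj hG hv h₂ h₃ h₁ n₂₃ n₁₂.symm n₁₃.symm k₂ k₃ k₁
  have a₂₁ : ¬ G.Adj z₂ z₁ := fun h => a₁₂ h.symm
  have a₃₁ : ¬ G.Adj z₃ z₁ := fun h => a₁₃ h.symm
  have a₃₂ : ¬ G.Adj z₃ z₂ := fun h => a₂₃ h.symm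
  obtain ⟨M, L, β, hM, hβ, hL₁, hL₂, hL₃, H⟩ :=
    exists_base_star hG hv h₁ h₂ h₃ n₁₂ n₁₃ n₂₃ k₁ k₂ k₃
  have c₁ := hβ z₁ (by simp [hM]) h₁.ne'
  have c₂ := hβ z₂ (by simp [hM]) h₂.ne'
  have c₃ := hβ z₃ (by simp [hM]) h₃.ne'
  have f₁ : (M.filter (G.Adj z₁)).card = 1 := by
    simp [hM, Finset.filter_insert, Finset.filter_singleton, h₁.symm, a₁₂, a₁₃]
  have f₂ : (M.filter (G.Adj z₂)).card = 1 := by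
    simp [hM, Finset.filter_insert, Finset.filter_singleton, h₂.symm, a₂₁, a₂₃]
  have f₃ : (M.filter (G.Adj z₃)).card = 1 := by
    simp [hM, Finset.filter_insert, Finset.filter_singleton, h₃.symm, a₃₁, a₃₂]
  obtain ⟨-, g₁⟩ := k₁.avail hL₁.1 (by omega) c₁.2 hL₁.2
  obtain ⟨-, g₂⟩ := k₂.avail hL₂.1 (by omega) c₂.2 hL₂.2
  obtain ⟨-, g₃⟩ := k₃.avail hL₃.1 (by omega) c₃.2 hL₃.2
  obtain ⟨c₁, hc₁, c₂, hc₂, c₃, hc₃, h, hh, p₁, p₂, p₃, e₁, e₂, e₃, q₁, q₂, q₃⟩ :=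
    exists_raise_three _ _ _ g₁ g₂ g₃
  exact H c₁ hc₁ c₂ hc₂ c₃ hc₃ h hh p₁ p₂ p₃ e₁ e₂ e₃ q₁ q₂ q₃ (fun h => (a₁₂ h).elim)
    (fun h => (a₁₃ h).elim) (fun h => (a₂₃ h).elim)

end TotalWeighting

theorem lemma3p4 :
    TotalWeighting.IsTwoReducible.{u} TotalWeighting.configA ∧
    TotalWeighting.IsTwoReducible.{u} TotalWeighting.configB ∧
    TotalWeighting.IsTwoReducible.{u} TotalWeighting.configC ∧
    TotalWeighting.IsTwoReducible.{u} TotalWeighting.configD ∧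
    TotalWeighting.IsTwoReducible.{u} TotalWeighting.configE ∧
    TotalWeighting.IsTwoReducible.{u} TotalWeighting.configF ∧
    TotalWeighting.IsTwoReducible.{u} TotalWeighting.configG :=
  ⟨TotalWeighting.isTwoReducible_configA, TotalWeighting.isTwoReducible_configB,
    TotalWeighting.isTwoReducible_configC, TotalWeighting.isTwoReducible_configD,
    TotalWeighting.isTwoReducible_configE, TotalWeighting.isTwoReducible_configF,
    TotalWeighting.isTwoReducible_configG⟩
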